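/- Let $(\Theta,d_\Theta)$ and $(\Xi,d_\Xi)$ be complete separable metric spaces with Borel probability measures $\nu$ on $\Theta$ and $\chi$ on $\Xi^2$ (with the maximum metric). **Marked graphs.** A marked graph is a simple graph with a mark $\tau(v)\in\Theta$ on each vertex and a mark $\xi(u,v)\in\Xi$ on each oriented edge. Let $\bar{\mathcal G}_*$ be the set of isomorphism classes of connected, locally finite, rooted marked graphs (isomorphisms preserve edges, marks and root). For $r\in\{0,1,2,\dots\}$ and $\delta>0$, call $(r,\delta)$ good for two such rooted graphs if there is a root-preserving isomorphism between the underlying graphs of their balls of radius $r$ around the roots under which all corresponding vertex and edge marks are at distance $<\delta$. Equip $\bar{\mathcal G}_*$ with the distance $\inf\{\frac1{1+r}+\delta:(r,\delta)\text{ good}\}$ and its Borel $\sigma$-algebra, and $\mathcal P(\bar{\mathcal G}_*)$ with the weak topology, metrized by the Lévy–Prokhorov metric; $B_\delta(\mu)$ is the open ball of radius $\delta$ about $\mu$. For a finite nonempty marked graph $G$ with vertex set $V$ put $U(G)=\frac1{|V|}\sum_{v\in V}\delta_{[G(v),v]}$, where $G(v)$ is the marked connected component of $v$. **Large deviations.**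 A sequence $(X_n)_{n\ge1}$ with values in a topological space $\mathfrak X$ satisfies a large deviation principle with rate function $I:\mathfrak X\to[0,\infty]$ if $\limsup_n\frac1n\log\mathbb P(X_n\in F)\le-\inf_FI$ for all closed $F$ and $\liminf_n\frac1n\log\mathbb P(X_n\in O)\ge-\inf_OI$ for all open $O$. **Random graphs.** For each $n\ge1$ let $G_n$ be a random marked graph on $[n]$ with i.i.d. marks: given the underlying random graph with edge set $E_n$, the vertex marks are i.i.d. with law $\nu$; independently, the edges $e$ carry i.i.d. pairs $X_e=(X_e^1,X_e^2)$ with law $\chi$, and, by independent fair coins, the two orientations of $e$ receive the marks $X^1_e,X^2_e$ in one or the other order. Assume that the underlying graph satisfies the sparsity condition: for every $\varepsilon>0$, $$\limsup_{h\to\infty}\limsup_{S\to\infty}\limsup_{n\to\infty}\frac1n\log\mathbb P\Big(\frac1n\sum_{v\in[n]}\mathbf 1_{\{|[G_n,v]_h|>S\}}>\varepsilon\Big)=-\infty$$ (where $|[G_n,v]_h|$ is the number of vertices at graph distance at most $h$ from $v$), and $$\limsup_{a\to\infty}\limsup_{n\to\infty}\frac1n\log\mathbb P(|E_n|\ge an)=-\infty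 .$$ **Good partitions.** A tagged partition $\{(A_1,a_1),\dots,(A_\ell,a_\ell)\}$ of $\Theta$ consists of finitely many disjoint Borel cells $A_i$ (possibly empty) covering $\Theta$ and points $a_i\in\Theta$ with $a_i\in A_i$ whenever $A_i\neq\emptyset$; similarly $\{(B_j,b_j)\}_{j\le\ell'}$ for $\Xi$. The pair is $(\epsilon,\delta)$-good with respect to $(\nu,\chi)$ if $\operatorname{diam}A_i\le\epsilon$ for $i<\ell$, $\operatorname{diam}(B_i\times B_j)\le\epsilon$ for $i,j<\ell'$, $\nu(A_\ell)<\delta$ and $\chi\big(\bigcup_{i\le\ell'}(B_{\ell'}\times B_i)\cup(B_i\times B_{\ell'})\big)<\delta$. **Statement.** For each integer $k\ge1$ let $(\mathcal A_k,\mathcal B_k)$ be a $(\frac1{2k},e^{-k^2})$-good pair of tagged partitions of $\Theta$ and $\Xi$ with respect to $(\nu,\chi)$, and let $G_n^k$ be obtained from $G_n$ by replacing every mark by the tag of its cell. Suppose that for each $k$ the sequence $(U(G_n^k))_n$ satisfies a large deviation principle on $\mathcal P(\bar{\mathcal G}_*)$ with rate function $I^k$. Then $(U(G_n))_n$ satisfies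 a large deviation principle on $\mathcal P(\bar{\mathcal G}_*)$ with rate function $$I(\mu)=\limsup_{\delta\to0}\ \limsup_{k\to\infty}\ \inf_{\rho\in B_\delta(\mu)}I^k(\rho).$$ -/

import Mathlib

open MeasureTheory Filter Topology Set
open scoped ENNReal

noncomputable section

namespace SparseLDP

universe u w

/-! ### Marked graphs -/

/-- A simple graph on `V` with a mark in `Θ` on every vertex and a mark in `Ξ` on every
oriented edge. -/
structure MarkedGraph (V : Type) (Θ : Type u) (Ξ : Type w) where
  graph : SimpleGraph V
  vmark : V → Θ
  emark : ∀ a b : V, graph.Adj a b → Ξ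

/-- The marked graph obtained by applying maps to the vertex marks and to the edge marks. -/
def MarkedGraph.mapMarks {V : Type} {Θ : Type u} {Ξ : Type w} (G : MarkedGraph V Θ Ξ)
    (f : Θ → Θ) (g : Ξ → Ξ) : MarkedGraph V Θ Ξ where
  graph := G.graph
  vmark := fun v => f (G.vmark v)
  emark := fun a b h => g (G.emark a b h)

/-- A connected, locally finite, rooted marked graph (its vertex set is then automatically
finite or countably infinite). -/
structure RootedMarkedGraph (Θ : Type u) (Ξ : Type w) where
  V : Type
  toMarked : MarkedGraph V Θ Ξ
  root : V
  connected : toMarked.graph.Connected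
  locallyFinite : ∀ v, (toMarked.graph.neighborSet v).Finite

/-- The set of vertices at graph distance at most `r` from `v`. -/
def closedBall {V : Type} (G : SimpleGraph V) (v : V) (r : ℕ) : Set V :=
  {x | G.edist v x ≤ (r : ℕ∞)}

theorem self_mem_closedBall {V : Type} (G : SimpleGraph V) (v : V) (r : ℕ) :
    v ∈ closedBall G v r := by
  simp [closedBall]

theorem closedBall_mono {V : Type} (G : SimpleGraph V) (v : V) {r s : ℕ} (h : r ≤ s) :
    closedBall G v r ⊆ closedBall G v s := by
  intro x hx
  have hx' : G.edist v x ≤ (r : ℕ∞) := hx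
  exact hx'.trans (by exact_mod_cast h)

namespace RootedMarkedGraph

variable {Θ : Type u} {Ξ : Type w}

/-- The ball of radius `r` around the root. -/
def ball (a : RootedMarkedGraph Θ Ξ) (r : ℕ) : Set a.V :=
  closedBall a.toMarked.graph a.root r

/-- The underlying graph of the ball of radius `r` around the root. -/
abbrev ballGraph (a : RootedMarkedGraph Θ Ξ) (r : ℕ) : SimpleGraph (a.ball r) :=
  a.toMarked.graph.induce (a.ball r)

/-- Isomorphism of rooted marked graphs: a bijection of the vertex sets that preserves edges,
marks and the root. -/
def Isom (a b : RootedMarkedGraph Θ Ξ) : Prop :=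
  ∃ φ : a.toMarked.graph ≃g b.toMarked.graph,
    φ a.root = b.root ∧
    (∀ v, b.toMarked.vmark (φ v) = a.toMarked.vmark v) ∧
    ∀ (x y : a.V) (h : a.toMarked.graph.Adj x y),
      b.toMarked.emark (φ x) (φ y) (φ.map_adj_iff.2 h) = a.toMarked.emark x y h

theorem emark_congr {V : Type} (G : MarkedGraph V Θ Ξ) {x x' y y' : V}
    (hx : x = x') (hy : y = y') (h : G.graph.Adj x y) (h' : G.graph.Adj x' y') :
    G.emark x y h = G.emark x' y' h' := by
  subst hx; subst hy; rfl

theorem Isom.refl (a : RootedMarkedGraph Θ Ξ) : Isom a a :=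
  ⟨SimpleGraph.Iso.refl, rfl, fun _ => rfl, fun _ _ _ => rfl⟩

theorem Isom.symm {a b : RootedMarkedGraph Θ Ξ} (h : Isom a b) : Isom b a := by
  obtain ⟨φ, h0, h1, h2⟩ := h
  refine ⟨φ.symm, ?_, ?_, ?_⟩
  · rw [← h0]; simp
  · intro v
    rw [← h1]; simp
  · intro x y h
    rw [← h2]
    exact emark_congr _ (by simp) (by simp) _ _

theorem Isom.trans {a b c : RootedMarkedGraph Θ Ξ} (h : Isom a b) (h' : Isom b c) :
    Isom a c := by
  obtain ⟨φ, h0, h1, h2⟩ := h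
  obtain ⟨ψ, k0, k1, k2⟩ := h'
  refine ⟨φ.trans ψ, ?_, ?_, ?_⟩
  · simp [h0, k0]
  · intro v
    simp [h1, k1]
  · intro x y h
    rw [← h2 x y h, ← k2]
    rfl

instance instSetoid : Setoid (RootedMarkedGraph Θ Ξ) where
  r := Isom
  iseqv := ⟨Isom.refl, Isom.symm, Isom.trans⟩

theorem exists_pred {V : Type} (G : SimpleGraph V) (o v : V) (s : ℕ)
    (h : G.edist o v ≤ ((s + 1 : ℕ) : ℕ∞)) :
    v = o ∨ ∃ x, G.edist o x ≤ (s : ℕ∞) ∧ G.Adj x v := by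
  have hr : G.Reachable v o := by
    apply SimpleGraph.reachable_of_edist_ne_top
    rw [SimpleGraph.edist_comm]
    exact ne_top_of_le_ne_top (ENat.natCast_ne_top _) h
  obtain ⟨p, hp⟩ := hr.exists_walk_length_eq_edist
  cases p with
  | nil => exact Or.inl rfl
  | cons hadj q =>
    right
    refine ⟨_, ?_, hadj.symm⟩
    rw [SimpleGraph.edist_comm] at h
    rw [← hp] at h
    rw [SimpleGraph.edist_comm]
    refine q.edist_le.trans ?_
    have h' : (q.length + 1 : ℕ) ≤ s + 1 := by exact_mod_cast h
    exact_mod_cast Nat.le_of_succ_le_succ h'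

theorem edist_map_le {a b : RootedMarkedGraph Θ Ξ} {r : ℕ}
    (φ : a.ballGraph r ≃g b.ballGraph r)
    (h0 : (φ ⟨a.root, self_mem_closedBall _ _ _⟩ : b.V) = b.root) (s : ℕ) (hs : s ≤ r) :
    ∀ v : a.ball r, (v : a.V) ∈ a.ball s → (φ v : b.V) ∈ b.ball s := by
  induction s with
  | zero =>
    intro v hv
    have hv' : a.root = v := by
      have : a.toMarked.graph.edist a.root v ≤ ((0 : ℕ) : ℕ∞) := hv
      simpa using this
    have : v = ⟨a.root, self_mem_closedBall _ _ _⟩ := Subtype.ext hv'.symm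
    rw [this, h0]
    exact self_mem_closedBall _ _ _
  | succ s ih =>
    intro v hv
    rcases exists_pred _ _ _ _ hv with h | ⟨x, hx, hadj⟩
    · have : v = ⟨a.root, self_mem_closedBall _ _ _⟩ := Subtype.ext h
      rw [this, h0]
      exact self_mem_closedBall _ _ _
    · have hxs : x ∈ a.ball s := hx
      have hxr : x ∈ a.ball r := closedBall_mono _ _ (by omega) hxs
      have h1 : (φ ⟨x, hxr⟩ : b.V) ∈ b.ball s := ih (by omega) ⟨x, hxr⟩ hxs
      have hadj' : (a.ballGraph r).Adj ⟨x, hxr⟩ v := hadj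
      have h2 : b.toMarked.graph.Adj (φ ⟨x, hxr⟩ : b.V) (φ v : b.V) :=
        φ.map_adj_iff.2 hadj'
      have h3 : b.toMarked.graph.edist (φ ⟨x, hxr⟩ : b.V) (φ v : b.V) = 1 :=
        SimpleGraph.edist_eq_one_iff_adj.2 h2
      have h1' : b.toMarked.graph.edist b.root (φ ⟨x, hxr⟩ : b.V) ≤ (s : ℕ∞) := h1
      change b.toMarked.graph.edist b.root (φ v : b.V) ≤ ((s + 1 : ℕ) : ℕ∞)
      refine SimpleGraph.edist_triangle.trans (add_le_add h1' h3.le |>.trans ?_)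
      push_cast
      exact le_rfl

variable [MetricSpace Θ] [MetricSpace Ξ]

/-- The pair `(r, δ)` is good for `(a, b)`: some isomorphism between the (rooted) underlying
graphs of the balls of radius `r` brings all the corresponding marks within distance
less than `δ`. -/
def IsGood (a b : RootedMarkedGraph Θ Ξ) (r : ℕ) (δ : ℝ) : Prop :=
  ∃ φ : a.ballGraph r ≃g b.ballGraph r,
    (φ ⟨a.root, self_mem_closedBall _ _ _⟩ : b.V) = b.root ∧
    (∀ v : a.ball r, dist (a.toMarked.vmark v) (b.toMarked.vmark (φ v)) < δ) ∧
    ∀ (x y : a.ball r) (h : (a.ballGraph r).Adj x y),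
      dist (a.toMarked.emark x y h)
        (b.toMarked.emark (φ x) (φ y) (φ.map_adj_iff.2 h)) < δ

/-- The local distance between two representatives. -/
def repDist (a b : RootedMarkedGraph Θ Ξ) : ℝ :=
  sInf {t : ℝ | ∃ (r : ℕ) (δ : ℝ), 0 < δ ∧ IsGood a b r δ ∧ t = 1 / (1 + (r : ℝ)) + δ}

theorem IsGood.symm {a b : RootedMarkedGraph Θ Ξ} {r : ℕ} {δ : ℝ} (h : IsGood a b r δ) :
    IsGood b a r δ := by
  obtain ⟨φ, h0, h1, h2⟩ := h
  refine ⟨φ.symm, ?_, ?_, ?_⟩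
  · have : (⟨b.root, self_mem_closedBall _ _ _⟩ : b.ball r) =
        φ ⟨a.root, self_mem_closedBall _ _ _⟩ := Subtype.ext h0.symm
    rw [this]; simp
  · intro v
    have := h1 (φ.symm v)
    rw [dist_comm]
    simpa using this
  · intro x y h
    have h' : (a.ballGraph r).Adj (φ.symm x) (φ.symm y) := φ.symm.map_adj_iff.2 h
    have := h2 _ _ h'
    rw [dist_comm]
    convert this using 2
    exact emark_congr _ (by simp) (by simp) _ _

theorem IsGood.mono {a b : RootedMarkedGraph Θ Ξ} {r s : ℕ} {δ : ℝ} (h : IsGood a b r δ)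
    (hs : s ≤ r) : IsGood a b s δ := by
  obtain ⟨φ, h0, h1, h2⟩ := h
  have hsub : a.ball s ⊆ a.ball r := closedBall_mono _ _ hs
  have hsub' : b.ball s ⊆ b.ball r := closedBall_mono _ _ hs
  have h0' : (φ.symm ⟨b.root, self_mem_closedBall _ _ _⟩ : a.V) = a.root := by
    have : (⟨b.root, self_mem_closedBall _ _ _⟩ : b.ball r) =
        φ ⟨a.root, self_mem_closedBall _ _ _⟩ := Subtype.ext h0.symm
    rw [this]; simp
  refine ⟨⟨⟨fun v => ⟨φ ⟨v, hsub v.2⟩, edist_map_le φ h0 s hs ⟨v, hsub v.2⟩ v.2⟩,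
    fun v => ⟨φ.symm ⟨v, hsub' v.2⟩, edist_map_le φ.symm h0' s hs ⟨v, hsub' v.2⟩ v.2⟩,
    fun v => Subtype.ext (by simp), fun v => Subtype.ext (by simp)⟩, ?_⟩, ?_, ?_, ?_⟩
  · intro x y
    exact φ.map_adj_iff (v := ⟨x, hsub x.2⟩) (w := ⟨y, hsub y.2⟩)
  · exact h0
  · intro v
    exact h1 ⟨v, hsub v.2⟩
  · intro x y h
    exact h2 ⟨x, hsub x.2⟩ ⟨y, hsub y.2⟩ h

theorem IsGood.trans {a b c : RootedMarkedGraph Θ Ξ} {r : ℕ} {δ ε : ℝ}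
    (h : IsGood a b r δ) (h' : IsGood b c r ε) : IsGood a c r (δ + ε) := by
  obtain ⟨φ, h0, h1, h2⟩ := h
  obtain ⟨ψ, k0, k1, k2⟩ := h'
  refine ⟨φ.trans ψ, ?_, ?_, ?_⟩
  · have : φ ⟨a.root, self_mem_closedBall _ _ _⟩ =
      (⟨b.root, self_mem_closedBall _ _ _⟩ : b.ball r) := Subtype.ext h0
    change (ψ (φ _) : c.V) = _
    rw [this]; exact k0
  · intro v
    exact (dist_triangle _ _ _).trans_lt (add_lt_add (h1 v) (k1 (φ v)))
  · intro x y h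
    exact (dist_triangle _ _ _).trans_lt
      (add_lt_add (h2 x y h) (k2 (φ x) (φ y) (φ.map_adj_iff.2 h)))

theorem Isom.isGood {a b : RootedMarkedGraph Θ Ξ} (h : Isom a b) (r : ℕ) {δ : ℝ}
    (hδ : 0 < δ) : IsGood a b r δ := by
  obtain ⟨φ, h0, h1, h2⟩ := h
  have key : ∀ {a b : RootedMarkedGraph Θ Ξ} (φ : a.toMarked.graph ≃g b.toMarked.graph),
      φ a.root = b.root → ∀ v ∈ a.ball r, φ v ∈ b.ball r := by
    intro a b φ h0 v hv
    have hv' : a.toMarked.graph.edist a.root v ≤ (r : ℕ∞) := hv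
    change b.toMarked.graph.edist b.root (φ v) ≤ (r : ℕ∞)
    obtain ⟨p, hp⟩ := a.connected.exists_walk_length_eq_edist a.root v
    rw [← h0]
    refine ((p.map φ.toHom).edist_le).trans ?_
    rw [SimpleGraph.Walk.length_map, hp]
    exact hv'
  have h0' : φ.symm b.root = a.root := by rw [← h0]; simp
  refine ⟨⟨⟨fun v => ⟨φ v, key φ h0 v v.2⟩, fun v => ⟨φ.symm v, key φ.symm h0' v v.2⟩,
    fun v => Subtype.ext (by simp), fun v => Subtype.ext (by simp)⟩, ?_⟩, ?_, ?_, ?_⟩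
  · intro x y
    exact φ.map_adj_iff (v := x) (w := y)
  · exact h0
  · intro v
    have : dist (a.toMarked.vmark v) (b.toMarked.vmark (φ v)) < δ := by
      rw [h1 v, dist_self]; exact hδ
    exact this
  · intro x y h
    have : dist (a.toMarked.emark x y h)
      (b.toMarked.emark (φ x) (φ y) (φ.map_adj_iff.2 h)) < δ := by
      rw [h2 x y h, dist_self]; exact hδ
    exact this

theorem exists_isGood (a b : RootedMarkedGraph Θ Ξ) : ∃ δ : ℝ, 0 < δ ∧ IsGood a b 0 δ := by
  have hz : ∀ (c : RootedMarkedGraph Θ Ξ) (v : c.ball 0), (v : c.V) = c.root := by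
    intro c v
    have : c.toMarked.graph.edist c.root v ≤ ((0 : ℕ) : ℕ∞) := v.2
    have h : c.root = v := by simpa using this
    exact h.symm
  refine ⟨dist (a.toMarked.vmark a.root) (b.toMarked.vmark b.root) + 1, by positivity,
    ⟨⟨fun _ => ⟨b.root, self_mem_closedBall _ _ _⟩,
      fun _ => ⟨a.root, self_mem_closedBall _ _ _⟩,
      fun v => Subtype.ext (hz a v).symm, fun v => Subtype.ext (hz b v).symm⟩, ?_⟩,
    rfl, ?_, ?_⟩
  · intro x y
    have hx : x = y := Subtype.ext ((hz a x).trans (hz a y).symm)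
    subst hx
    simp
  · intro v
    have := hz a v
    simp [this]
  · intro x y h
    have hx : x = y := Subtype.ext ((hz a x).trans (hz a y).symm)
    exact absurd hx h.ne

theorem repDist_bddBelow (a b : RootedMarkedGraph Θ Ξ) :
    BddBelow {t : ℝ | ∃ (r : ℕ) (δ : ℝ), 0 < δ ∧ IsGood a b r δ ∧
      t = 1 / (1 + (r : ℝ)) + δ} := by
  refine ⟨0, ?_⟩
  rintro t ⟨r, δ, hδ, -, rfl⟩
  positivity

theorem repDist_nonneg (a b : RootedMarkedGraph Θ Ξ) : 0 ≤ repDist a b := by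
  refine Real.sInf_nonneg ?_
  rintro t ⟨r, δ, hδ, -, rfl⟩
  positivity

theorem repDist_comm (a b : RootedMarkedGraph Θ Ξ) : repDist a b = repDist b a := by
  unfold repDist
  congr 1
  ext t
  constructor <;> rintro ⟨r, δ, hδ, h, rfl⟩ <;> exact ⟨r, δ, hδ, h.symm, rfl⟩

theorem repDist_triangle (a b c : RootedMarkedGraph Θ Ξ) :
    repDist a c ≤ repDist a b + repDist b c := by
  refine le_of_forall_pos_lt_add fun ε hε => ?_
  obtain ⟨δ₁, hδ₁, hg₁⟩ := exists_isGood a b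
  obtain ⟨δ₂, hδ₂, hg₂⟩ := exists_isGood b c
  have e1 : repDist a b < repDist a b + ε / 2 := by linarith
  have e2 : repDist b c < repDist b c + ε / 2 := by linarith
  obtain ⟨_, ⟨r, δ, hδ, hg, rfl⟩, ht⟩ := (csInf_lt_iff (repDist_bddBelow a b)
    (Exists.intro _ ⟨0, δ₁, hδ₁, hg₁, rfl⟩)).1 e1
  obtain ⟨_, ⟨s, η, hη, hk, rfl⟩, ht'⟩ := (csInf_lt_iff (repDist_bddBelow b c)
    (Exists.intro _ ⟨0, δ₂, hδ₂, hg₂, rfl⟩)).1 e2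
  have hmem : repDist a c ≤ 1 / (1 + ((min r s : ℕ) : ℝ)) + (δ + η) :=
    csInf_le (repDist_bddBelow a c) ⟨min r s, δ + η, by positivity,
      (hg.mono (min_le_left r s)).trans (hk.mono (min_le_right r s)), rfl⟩
  have hr : 0 < 1 / (1 + (r : ℝ)) := by positivity
  have hs : 0 < 1 / (1 + (s : ℝ)) := by positivity
  have hmin : 1 / (1 + ((min r s : ℕ) : ℝ)) ≤ 1 / (1 + (r : ℝ)) + 1 / (1 + (s : ℝ)) := by
    rcases min_choice r s with h | h <;> rw [h] <;> linarith
  linarith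

theorem Isom.repDist_eq_zero {a b : RootedMarkedGraph Θ Ξ} (h : Isom a b) :
    repDist a b = 0 := by
  refine le_antisymm (le_of_forall_pos_lt_add fun ε hε => ?_) (repDist_nonneg a b)
  obtain ⟨n, hn⟩ := exists_nat_one_div_lt (half_pos hε)
  have : repDist a b ≤ 1 / (1 + (n : ℝ)) + ε / 2 / 2 :=
    csInf_le (repDist_bddBelow a b) ⟨n, ε / 2 / 2, by positivity,
      h.isGood n (by positivity), rfl⟩
  rw [add_comm 1 (n : ℝ)] at this
  linarith

theorem repDist_congr {a a' b b' : RootedMarkedGraph Θ Ξ} (h : Isom a a') (h' : Isom b b') :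
    repDist a b = repDist a' b' := by
  have e1 := h.repDist_eq_zero
  have e2 := h.symm.repDist_eq_zero
  have e3 := h'.repDist_eq_zero
  have e4 := h'.symm.repDist_eq_zero
  apply le_antisymm
  · have := repDist_triangle a a' b
    have := repDist_triangle a' b' b
    linarith
  · have := repDist_triangle a' a b'
    have := repDist_triangle a b b'
    linarith

end RootedMarkedGraph

/-! ### The space of isomorphism classes of rooted marked graphs -/

/-- The space of connected, locally finite, rooted marked graphs up to isomorphism. -/
def GStar (Θ : Type u) (Ξ : Type w) : Type (max 1 u w) :=
  Quotient (RootedMarkedGraph.instSetoid (Θ := Θ) (Ξ := Ξ))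

/-- The isomorphism class of a rooted marked graph. -/
def GStar.mk {Θ : Type u} {Ξ : Type w} (a : RootedMarkedGraph Θ Ξ) : GStar Θ Ξ :=
  Quotient.mk _ a

section Topology

variable {Θ : Type u} {Ξ : Type w} [MetricSpace Θ] [MetricSpace Ξ]

/-- The local metric. -/
instance GStar.instPseudoMetricSpace : PseudoMetricSpace (GStar Θ Ξ) where
  dist := Quotient.lift₂ RootedMarkedGraph.repDist
    (fun _ _ _ _ h h' => RootedMarkedGraph.repDist_congr h h')
  dist_self := by
    intro x
    induction x using Quotient.inductionOn with
    | h a => exact (RootedMarkedGraph.Isom.refl a).repDist_eq_zero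
  dist_comm := by
    intro x y
    induction x using Quotient.inductionOn with
    | h a =>
      induction y using Quotient.inductionOn with
      | h b => exact RootedMarkedGraph.repDist_comm a b
  dist_triangle := by
    intro x y z
    induction x using Quotient.inductionOn with
    | h a =>
      induction y using Quotient.inductionOn with
      | h b =>
        induction z using Quotient.inductionOn with
        | h c => exact RootedMarkedGraph.repDist_triangle a b c

/-- The Borel σ-algebra of the local metric. -/
instance GStar.instMeasurableSpace : MeasurableSpace (GStar Θ Ξ) := borel _

instance GStar.instBorelSpace : BorelSpace (GStar Θ Ξ) := ⟨rfl⟩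

end Topology

/-! ### Empirical neighborhood distribution -/

/-- The connected component of `v`, rooted at `v`, with the induced marks. -/
def MarkedGraph.rootedComponent {V : Type} [Finite V] {Θ : Type u} {Ξ : Type w}
    (G : MarkedGraph V Θ Ξ) (v : V) : RootedMarkedGraph Θ Ξ where
  V := (G.graph.connectedComponentMk v).supp
  toMarked :=
    { graph := G.graph.induce (G.graph.connectedComponentMk v).supp
      vmark := fun x => G.vmark x
      emark := fun x y h => G.emark x y h }
  root := ⟨v, rfl⟩
  connected := (G.graph.connectedComponentMk v).connected_toSimpleGraph
  locallyFinite := fun _ => Set.toFinite _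

/-- The empirical neighborhood distribution `U(G) = |V|⁻¹ ∑_v δ_[G(v), v]` of a finite
marked graph. -/
def empirical {V : Type} [Fintype V] [Nonempty V] {Θ : Type u} {Ξ : Type w}
    [MetricSpace Θ] [MetricSpace Ξ] (G : MarkedGraph V Θ Ξ) :
    ProbabilityMeasure (GStar Θ Ξ) :=
  ⟨(Fintype.card V : ℝ≥0∞)⁻¹ • ∑ v : V, Measure.dirac (GStar.mk (G.rootedComponent v)),
    ⟨by
      simp only [Measure.smul_apply, Measure.coe_finsetSum, Finset.sum_apply, measure_univ,
        Finset.sum_const, Finset.card_univ, nsmul_eq_mul, mul_one, smul_eq_mul]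
      exact ENNReal.inv_mul_cancel (by simp) (by simp)⟩⟩

/-! ### Large deviation principle -/

/-- The sequence `Y n`, defined on the probability spaces `(Ω n, P n)`, satisfies the (strong)
large deviation principle with speed `n` and rate function `I`. Here `ENNReal.log` takes the
value `-∞` at `0`, and infima over the empty set are `+∞`. -/
def SatisfiesLDP {X : Type*} [TopologicalSpace X] {Ω : ℕ+ → Type*}
    [∀ n, MeasurableSpace (Ω n)] (P : ∀ n, Measure (Ω n)) (Y : ∀ n, Ω n → X)
    (I : X → ℝ≥0∞) : Prop :=
  (∀ F : Set X, IsClosed F →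
    limsup (fun n : ℕ+ => ENNReal.log (P n {ω | Y n ω ∈ F}) / ((n : ℕ) : EReal)) atTop
      ≤ -((⨅ x ∈ F, I x : ℝ≥0∞) : EReal)) ∧
  (∀ O : Set X, IsOpen O →
    -((⨅ x ∈ O, I x : ℝ≥0∞) : EReal) ≤
      liminf (fun n : ℕ+ => ENNReal.log (P n {ω | Y n ω ∈ O}) / ((n : ℕ) : EReal)) atTop)

/-! ### Random graphs with i.i.d. marks -/

/-- The sparsity condition for a sequence of random graphs, the `n`-th one on `n` vertices. -/
def Sparse {Ω : ℕ+ → Type*} [∀ n, MeasurableSpace (Ω n)] (P : ∀ n, Measure (Ω n))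
    (G : ∀ n : ℕ+, Ω n → SimpleGraph (Fin n)) : Prop :=
  (∀ ε : ℝ, 0 < ε →
    limsup (fun h : ℕ => limsup (fun S : ℕ => limsup (fun n : ℕ+ =>
      ENNReal.log (P n {ω | ε <
          ({v : Fin n | S < (closedBall (G n ω) v h).ncard}.ncard : ℝ) / ((n : ℕ) : ℝ)})
        / ((n : ℕ) : EReal)) atTop) atTop) atTop = ⊥) ∧
  limsup (fun a : ℝ => limsup (fun n : ℕ+ =>
      ENNReal.log (P n {ω | a * ((n : ℕ) : ℝ) ≤ ((G n ω).edgeSet.ncard : ℝ)})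
        / ((n : ℕ) : EReal)) atTop) atTop = ⊥

/-- The marked graph with underlying graph `H`, vertex marks `O` and edge marks produced by
`X` and the coins `C`: for an edge `e = {a, b}` with `a < b` and `X e = (x₁, x₂)`, the oriented
edges `(a, b)` and `(b, a)` receive the marks `x₁` and `x₂` if `C e = true`, and `x₂` and `x₁`
if `C e = false`. The values of `X` and `C` outside the edge set of `H` are not used. -/
def assemble {Θ : Type u} {Ξ : Type w} {n : ℕ} (H : SimpleGraph (Fin n)) (O : Fin n → Θ)
    (X : Sym2 (Fin n) → Ξ × Ξ) (C : Sym2 (Fin n) → Bool) : MarkedGraph (Fin n) Θ Ξ where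
  graph := H
  vmark := O
  emark := fun a b _ => if decide (a < b) = C s(a, b) then (X s(a, b)).1 else (X s(a, b)).2

/-- The random variables `O v` are i.i.d. with law `ν`, the `X e` are i.i.d. with law `χ`,
the `C e` are i.i.d. fair coins, and these families and the random graph `G` are independent:
the joint law of all of them is a product measure. -/
structure IsIIDMarking {Θ : Type u} {Ξ : Type w} [MeasurableSpace Θ] [MeasurableSpace Ξ]
    (ν : Measure Θ) (χ : Measure (Ξ × Ξ)) {n : ℕ} {Ω : Type*} [MeasurableSpace Ω]
    (P : Measure Ω) (G : Ω → SimpleGraph (Fin n)) (O : Ω → Fin n → Θ)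
    (X : Ω → Sym2 (Fin n) → Ξ × Ξ) (C : Ω → Sym2 (Fin n) → Bool) : Prop where
  measurable_graph : Measurable G
  measurable_vmark : Measurable O
  measurable_emark : Measurable X
  measurable_coin : Measurable C
  law : P.map (fun ω => (G ω, O ω, X ω, C ω)) =
    (P.map G).prod ((Measure.pi fun _ => ν).prod
      ((Measure.pi fun _ => χ).prod
        (Measure.pi fun _ => (PMF.uniformOfFintype Bool).toMeasure)))

/-! ### Tagged partitions -/

/-- A finite measurable tagged partition of `α` with cells `A_0, …, A_m`, given by the map that
sends a point to the index of its cell. Cells may be empty; the tag of a nonempty cell lies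
in it. -/
structure TaggedPartition (α : Type*) [MeasurableSpace α] where
  m : ℕ
  index : α → Fin (m + 1)
  measurable_index : Measurable index
  tag : Fin (m + 1) → α
  tag_mem : ∀ x, index (tag (index x)) = index x

namespace TaggedPartition

variable {α : Type*} [MeasurableSpace α]

/-- The `i`-th cell. -/
def cell (A : TaggedPartition α) (i : Fin (A.m + 1)) : Set α := A.index ⁻¹' {i}

/-- The projection that maps a point to the tag of its cell. -/
def proj (A : TaggedPartition α) (x : α) : α := A.tag (A.index x)

/-- The exceptional (last) cell. -/
def lastCell (A : TaggedPartition α) : Set α := A.cell (Fin.last A.m)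

end TaggedPartition

/-- `(A, B)` is an `(ε, δ)`-good pair of tagged partitions with respect to `(ν, χ)`. The second
smallness condition concerns the pairs with at least one entry in the exceptional cell. -/
structure IsGoodPair {Θ : Type u} {Ξ : Type w} [MetricSpace Θ] [MeasurableSpace Θ]
    [MetricSpace Ξ] [MeasurableSpace Ξ] (ν : Measure Θ) (χ : Measure (Ξ × Ξ)) (ε δ : ℝ)
    (A : TaggedPartition Θ) (B : TaggedPartition Ξ) : Prop where
  diam_left : ∀ i, i ≠ Fin.last A.m → Metric.ediam (A.cell i) ≤ ENNReal.ofReal ε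
  diam_right : ∀ i j, i ≠ Fin.last B.m → j ≠ Fin.last B.m →
    Metric.ediam (B.cell i ×ˢ B.cell j) ≤ ENNReal.ofReal ε
  measure_left : ν A.lastCell < ENNReal.ofReal δ
  measure_right : χ (⋃ i, (B.lastCell ×ˢ B.cell i) ∪ (B.cell i ×ˢ B.lastCell))
    < ENNReal.ofReal δ

end SparseLDP

end

noncomputable section

namespace SparseLDP

universe u w

/-! ### Exponential rates -/

/-! On the exponential scale the discretized graphs cannot be told apart from the original ones: for
all δ and c, once k is large, the Lévy–Prokhorov distance between the two empirical measures is at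
least δ with probability at most e^{-cn}. Such exponentially good approximations pass the lower
bound on to the limit, and the upper bound for small balls, hence for compact sets. Exponential
tightness extends it to closed sets. This is `ExpApprox.satisfiesLDP`; it asks neither compact level
sets nor semicontinuity of the I^k.

Both probabilistic inputs rest on `Sparse.exists_exceptional_bound`. Declare marks in some set of
probability at most p exceptional. If there are at most an edges, a union bound over subsets shows
that ηn exceptional marks occur with probability at most 2^{an} p^{ηn}, which is below e^{-cn} for
small p. By sparsity all but a small fraction of the balls of radius 2h have at most S vertices, and
an exceptional vertex can spoil the h-neighborhoods of at most S centers of such balls. So few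
neighborhoods are spoiled. The threshold p depends neither on n nor on the choice of the exceptional
set.

With the last cells as exceptional sets this gives the approximation (`expApprox_discretization`):
away from spoiled centers, discretization moves every mark of the h-ball by less than 1/k. With
complements of compact sets, at all scales j at once, it gives tightness (`expTight_empirical`):
neighborhoods are encoded as labelled configurations in a product space, where compact sets come
from Tychonoff and tight families from Prokhorov, and the result is pushed forward along the
continuous map to isomorphism classes. Completeness of the local metric is therefore never needed.
-/

theorem log_div_le_iff {x : ℝ≥0∞} {n : ℕ+} {r : ℝ} :
    ENNReal.log x / ((n : ℕ) : EReal) ≤ r ↔ x ≤ ENNReal.ofReal (Real.exp (n * r)) := by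
  have hn : (0 : EReal) < ((n : ℕ) : EReal) := by exact_mod_cast n.pos
  have hn' : ((n : ℕ) : EReal) ≠ ⊤ := EReal.natCast_ne_top _
  rw [EReal.div_le_iff_le_mul hn hn', ← ENNReal.log_le_log_iff,
    ENNReal.log_ofReal_of_pos (Real.exp_pos _), Real.log_exp]
  push_cast
  rfl

theorem le_log_div_iff {x : ℝ≥0∞} {n : ℕ+} {r : ℝ} :
    r ≤ ENNReal.log x / ((n : ℕ) : EReal) ↔ ENNReal.ofReal (Real.exp (n * r)) ≤ x := by
  have hn : (0 : EReal) < ((n : ℕ) : EReal) := by exact_mod_cast n.pos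
  have hn' : ((n : ℕ) : EReal) ≠ ⊤ := EReal.natCast_ne_top _
  rw [EReal.le_div_iff_mul_le hn hn', ← ENNReal.log_le_log_iff,
    ENNReal.log_ofReal_of_pos (Real.exp_pos _), Real.log_exp, mul_comm]
  push_cast
  rfl

theorem eventually_le_exp_of_limsup_lt {x : ℕ+ → ℝ≥0∞} {r : ℝ}
    (h : limsup (fun n : ℕ+ => ENNReal.log (x n) / ((n : ℕ) : EReal)) atTop < r) :
    ∀ᶠ n : ℕ+ in atTop, x n ≤ ENNReal.ofReal (Real.exp (n * r)) :=
  (eventually_lt_of_limsup_lt h).mono fun _ hn => log_div_le_iff.1 hn.le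

theorem limsup_le_of_eventually_le_exp {x : ℕ+ → ℝ≥0∞} {r : ℝ}
    (h : ∀ᶠ n : ℕ+ in atTop, x n ≤ ENNReal.ofReal (Real.exp (n * r))) :
    limsup (fun n : ℕ+ => ENNReal.log (x n) / ((n : ℕ) : EReal)) atTop ≤ r :=
  limsup_le_of_le (h := h.mono fun _ hn => log_div_le_iff.2 hn)

theorem eventually_exp_le_of_lt_liminf {x : ℕ+ → ℝ≥0∞} {r : ℝ}
    (h : r < liminf (fun n : ℕ+ => ENNReal.log (x n) / ((n : ℕ) : EReal)) atTop) :
    ∀ᶠ n : ℕ+ in atTop, ENNReal.ofReal (Real.exp (n * r)) ≤ x n :=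
  (eventually_lt_of_lt_liminf h).mono fun _ hn => le_log_div_iff.1 hn.le

theorem le_liminf_of_eventually_exp_le {x : ℕ+ → ℝ≥0∞} {r : ℝ}
    (h : ∀ᶠ n : ℕ+ in atTop, ENNReal.ofReal (Real.exp (n * r)) ≤ x n) :
    r ≤ liminf (fun n : ℕ+ => ENNReal.log (x n) / ((n : ℕ) : EReal)) atTop :=
  le_liminf_of_le (h := h.mono fun _ hn => le_log_div_iff.2 hn)

/-- Any gain in the exponential rate absorbs constant factors, so finite union bounds are free. -/
theorem eventually_natCast_mul_exp_le (m : ℕ) {r s : ℝ} (h : r < s) :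
    ∀ᶠ n : ℕ+ in atTop,
      (m : ℝ≥0∞) * ENNReal.ofReal (Real.exp (n * r)) ≤ ENNReal.ofReal (Real.exp (n * s)) := by
  have h1 : Tendsto (fun n : ℕ+ => ((n : ℕ) : ℝ) * (s - r)) atTop atTop :=
    (tendsto_natCast_atTop_atTop.comp tendsto_PNat_val_atTop_atTop).atTop_mul_const
      (sub_pos.2 h)
  filter_upwards [(Real.tendsto_exp_atTop.comp h1).eventually_ge_atTop (m : ℝ)] with n hn
  rw [← ENNReal.ofReal_natCast, ← ENNReal.ofReal_mul (by positivity)]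
  apply ENNReal.ofReal_le_ofReal
  calc (m : ℝ) * Real.exp (n * r) ≤ Real.exp (((n : ℕ) : ℝ) * (s - r)) * Real.exp (n * r) := by
        gcongr; exact hn
    _ = Real.exp (n * s) := by rw [← Real.exp_add]; ring_nf

/-! ### Exponentially good approximations -/

section ExponentialApproximation

variable {M : Type*} [PseudoMetricSpace M] {Ω : ℕ+ → Type*} [∀ n, MeasurableSpace (Ω n)]
  {P : ∀ n, Measure (Ω n)} {Y : ∀ n, Ω n → M} {Z : ℕ+ → ∀ n, Ω n → M} {I : ℕ+ → M → ℝ≥0∞}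

/-- The rate function of the limit of exponentially good approximations. -/
def limitRate (I : ℕ+ → M → ℝ≥0∞) (x : M) : ℝ≥0∞ :=
  limsup (fun δ : ℝ => limsup (fun k : ℕ+ => ⨅ y ∈ {y : M | dist x y < δ}, I k y) atTop)
    (𝓝[>] (0 : ℝ))

/-- The `Z k` are exponentially good approximations of `Y`, uniformly in `n`. -/
def ExpApprox (P : ∀ n, Measure (Ω n)) (Y : ∀ n, Ω n → M) (Z : ℕ+ → ∀ n, Ω n → M) : Prop :=
  ∀ δ : ℝ, 0 < δ → ∀ c : ℝ, ∃ k₀ : ℕ+, ∀ k ≥ k₀, ∀ n : ℕ+,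
    P n {ω | δ ≤ dist (Y n ω) (Z k n ω)} ≤ ENNReal.ofReal (Real.exp (n * -c))

/-- Exponential tightness, uniformly in `n`. -/
def ExpTight {M : Type*} [TopologicalSpace M]
    (P : ∀ n, Measure (Ω n)) (Y : ∀ n, Ω n → M) : Prop :=
  ∀ c : ℝ, ∃ K : Set M, IsCompact K ∧ ∀ n : ℕ+,
    P n {ω | Y n ω ∉ K} ≤ ENNReal.ofReal (Real.exp (n * -c))

/-- A limit rate above c provides arbitrarily late k whose infimum over some δ-ball exceeds c, and
one k late enough for the approximation suffices. If `Y` is within δ/3 of x, then `Z k` lies in the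
closed ball of radius 2δ/3, inside the open δ-ball, or is at distance at least δ/3 from `Y`. -/
theorem ExpApprox.exists_ball_bound (hZ : ∀ k, SatisfiesLDP P (Z k) (I k))
    (happ : ExpApprox P Y Z) {c : ℝ} {x : M} (hx : ((c : ℝ) : EReal) < (limitRate I x : EReal)) :
    ∃ δ : ℝ, 0 < δ ∧ ∀ᶠ n : ℕ+ in atTop,
      P n {ω | dist x (Y n ω) < δ} ≤ 2 * ENNReal.ofReal (Real.exp (n * -c)) := by
  obtain ⟨δ, hδ, hfr⟩ : ∃ δ : ℝ, 0 < δ ∧ ∃ᶠ k : ℕ+ in atTop,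
      ((c : ℝ) : EReal) < ((⨅ y ∈ {y : M | dist x y < δ}, I k y : ℝ≥0∞) : EReal) := by
    -- For negative c any radius works, since rates are nonnegative; otherwise c can be moved into
    -- `ℝ≥0∞`.
    rcases lt_or_ge c 0 with hc | hc
    · refine ⟨1, one_pos, Frequently.of_forall fun k => ?_⟩
      exact lt_of_lt_of_le (by exact_mod_cast hc) (EReal.coe_ennreal_nonneg _)
    have hcc : ((c : ℝ) : EReal) = ((ENNReal.ofReal c : ℝ≥0∞) : EReal) := by
      rw [EReal.coe_ennreal_ofReal, max_eq_left hc]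
    rw [hcc, EReal.coe_ennreal_lt_coe_ennreal_iff] at hx
    have h1 := frequently_lt_of_lt_limsup (by isBoundedDefault) hx
    obtain ⟨δ, h2, hδ⟩ := (h1.and_eventually self_mem_nhdsWithin).exists
    refine ⟨δ, hδ, ?_⟩
    have h3 := frequently_lt_of_lt_limsup (by isBoundedDefault) h2
    refine h3.mono fun k hk => ?_
    rw [hcc, EReal.coe_ennreal_lt_coe_ennreal_iff]
    exact hk
  obtain ⟨k₀, hk₀⟩ := happ (δ / 3) (by positivity) c
  obtain ⟨k, hk, hkk⟩ := (hfr.and_eventually (eventually_ge_atTop k₀)).exists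
  refine ⟨δ / 3, by positivity, ?_⟩
  have hF : IsClosed {y : M | dist x y ≤ 2 * (δ / 3)} :=
    isClosed_le (by fun_prop) continuous_const
  have hlt : limsup (fun n : ℕ+ => ENNReal.log
      (P n {ω | Z k n ω ∈ {y : M | dist x y ≤ 2 * (δ / 3)}}) / ((n : ℕ) : EReal)) atTop
      < ((-c : ℝ) : EReal) := by
    refine ((hZ k).1 _ hF).trans_lt ?_
    rw [EReal.coe_neg, EReal.neg_lt_neg_iff]
    refine hk.trans_le (EReal.coe_ennreal_le_coe_ennreal_iff.2 ?_)
    refine biInf_mono fun y hy => ?_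
    have hy' : dist x y ≤ 2 * (δ / 3) := hy
    show dist x y < δ
    linarith
  filter_upwards [eventually_le_exp_of_limsup_lt hlt] with n hn
  rw [two_mul]
  refine (measure_mono ?_).trans ((measure_union_le _ _).trans (add_le_add hn (hk₀ k hkk n)))
  intro ω hω
  by_cases h : δ / 3 ≤ dist (Y n ω) (Z k n ω)
  · exact Or.inr h
  · left
    have hω' : dist x (Y n ω) < δ / 3 := hω
    have := dist_triangle x (Y n ω) (Z k n ω)
    show dist x (Z k n ω) ≤ 2 * (δ / 3)
    push Not at h
    linarith

/-- Up to an event of probability e^{ns}, exponential tightness replaces `F` by the compact set `K ∩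
F`, which finitely many balls from `ExpApprox.exists_ball_bound` cover. -/
theorem ExpApprox.upper_bound [∀ n, IsProbabilityMeasure (P n)]
    (hZ : ∀ k, SatisfiesLDP P (Z k) (I k)) (happ : ExpApprox P Y Z) (ht : ExpTight P Y)
    {F : Set M} (hF : IsClosed F) :
    limsup (fun n : ℕ+ => ENNReal.log (P n {ω | Y n ω ∈ F}) / ((n : ℕ) : EReal)) atTop
      ≤ -((⨅ x ∈ F, limitRate I x : ℝ≥0∞) : EReal) := by
  by_contra! hcon
  obtain ⟨r, hr1, hr2⟩ := EReal.lt_iff_exists_real_btwn.1 hcon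
  -- The gap between s and r pays for the number of terms in the union bound.
  obtain ⟨s, hs1, hs2⟩ := EReal.lt_iff_exists_real_btwn.1 hr1
  have hsr : s < r := by exact_mod_cast hs2
  obtain ⟨K, hK, hKP⟩ := ht (-s)
  have hball : ∀ x ∈ F, ∃ δ : ℝ, 0 < δ ∧ ∀ᶠ n : ℕ+ in atTop,
      P n {ω | dist x (Y n ω) < δ} ≤ 2 * ENNReal.ofReal (Real.exp (n * s)) := by
    intro x hx
    have : ((-s : ℝ) : EReal) < (limitRate I x : EReal) := by
      rw [EReal.coe_neg, EReal.neg_lt_comm]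
      refine lt_of_le_of_lt ?_ hs1
      rw [EReal.neg_le_neg_iff, EReal.coe_ennreal_le_coe_ennreal_iff]
      exact biInf_le _ hx
    simpa using happ.exists_ball_bound hZ this
  choose! δ hδ hδP using hball
  obtain ⟨t, htF, htc⟩ := (hK.inter_right hF).elim_nhds_subcover
    (fun x => {y | dist x y < δ x})
    (fun x hx => by
      refine mem_of_superset (Metric.ball_mem_nhds x (hδ x hx.2)) fun y hy => ?_
      rw [Metric.mem_ball, dist_comm] at hy
      exact hy)
  have hall : ∀ᶠ n : ℕ+ in atTop, ∀ x ∈ t,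
      P n {ω | dist x (Y n ω) < δ x} ≤ 2 * ENNReal.ofReal (Real.exp (n * s)) :=
    (Finset.eventually_all t).2 fun x hx => hδP x (htF x hx).2
  refine absurd (limsup_le_of_eventually_le_exp (r := r) ?_) (not_le.2 hr2)
  filter_upwards [hall, eventually_natCast_mul_exp_le (1 + t.card * 2) hsr] with n h1 h2
  refine le_trans ?_ h2
  have hsub : {ω | Y n ω ∈ F} ⊆ {ω | Y n ω ∉ K} ∪ ⋃ x ∈ t, {ω | dist x (Y n ω) < δ x} := by
    intro ω hω
    by_cases hωK : Y n ω ∈ K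
    · right
      have := htc ⟨hωK, hω⟩
      simpa using this
    · exact Or.inl hωK
  have h3 := hKP n
  rw [neg_neg] at h3
  calc P n {ω | Y n ω ∈ F}
      ≤ P n {ω | Y n ω ∉ K} + P n (⋃ x ∈ t, {ω | dist x (Y n ω) < δ x}) :=
        (measure_mono hsub).trans (measure_union_le _ _)
    _ ≤ ENNReal.ofReal (Real.exp (n * s)) +
        ∑ x ∈ t, 2 * ENNReal.ofReal (Real.exp (n * s)) := by
        refine add_le_add h3 ((measure_biUnion_finset_le _ _).trans ?_)
        exact Finset.sum_le_sum h1
    _ = _ := by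
        rw [Finset.sum_const, nsmul_eq_mul]
        push_cast
        ring

/-- A limit rate below -r makes the infima small for all small δ and all late k, so k can also be
taken late enough for the approximation. The mass of `Z k` near x is then at least 2e^{nr}, and the
approximation error takes away at most e^{nr}. -/
theorem ExpApprox.lower_bound
    (hZ : ∀ k, SatisfiesLDP P (Z k) (I k)) (happ : ExpApprox P Y Z)
    {U : Set M} (hU : IsOpen U) :
    -((⨅ x ∈ U, limitRate I x : ℝ≥0∞) : EReal) ≤
      liminf (fun n : ℕ+ => ENNReal.log (P n {ω | Y n ω ∈ U}) / ((n : ℕ) : EReal)) atTop := by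
  by_contra! hcon
  obtain ⟨r, hr1, hr2⟩ := EReal.lt_iff_exists_real_btwn.1 hcon
  rw [EReal.lt_neg_comm, ← EReal.coe_neg] at hr2
  have hr0 : 0 ≤ -r := by
    have h0 := (EReal.coe_ennreal_nonneg (⨅ x ∈ U, limitRate I x)).trans hr2.le
    exact_mod_cast h0
  have hrr : ((-r : ℝ) : EReal) = ((ENNReal.ofReal (-r) : ℝ≥0∞) : EReal) := by
    rw [EReal.coe_ennreal_ofReal, max_eq_left hr0]
  rw [hrr, EReal.coe_ennreal_lt_coe_ennreal_iff] at hr2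
  obtain ⟨x, hx, hxr⟩ : ∃ x ∈ U, limitRate I x < ENNReal.ofReal (-r) := by
    simpa only [iInf_lt_iff, exists_prop] using hr2
  obtain ⟨δ₀, hδ₀, hball⟩ := Metric.isOpen_iff.1 hU x hx
  have h1 := eventually_lt_of_limsup_lt hxr (by isBoundedDefault)
  have h2 : ∀ᶠ δ : ℝ in 𝓝[>] 0, δ < δ₀ / 2 :=
    eventually_nhdsWithin_of_eventually_nhds (eventually_lt_nhds (by positivity))
  obtain ⟨δ, hδ1, hδ2⟩ := (h1.and h2).exists
  have h3 := eventually_lt_of_limsup_lt hδ1 (by isBoundedDefault)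
  obtain ⟨k₀, hk₀⟩ := happ (δ₀ / 2) (by positivity) (-r)
  obtain ⟨k, hk, hkk⟩ := (h3.and (eventually_ge_atTop k₀)).exists
  have hopen : IsOpen {y : M | dist x y < δ} := isOpen_lt (by fun_prop) continuous_const
  have hlt : (r : EReal) < liminf (fun n : ℕ+ => ENNReal.log
      (P n {ω | Z k n ω ∈ {y : M | dist x y < δ}}) / ((n : ℕ) : EReal)) atTop := by
    refine lt_of_lt_of_le ?_ ((hZ k).2 _ hopen)
    rw [EReal.lt_neg_comm, ← EReal.coe_neg, hrr, EReal.coe_ennreal_lt_coe_ennreal_iff]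
    exact hk
  obtain ⟨s, hs1, hs2⟩ := EReal.lt_iff_exists_real_btwn.1 hlt
  have hrs : r < s := by exact_mod_cast hs1
  refine absurd (le_liminf_of_eventually_exp_le (r := r) ?_) (not_le.2 hr1)
  filter_upwards [eventually_exp_le_of_lt_liminf hs2, eventually_natCast_mul_exp_le 2 hrs]
    with n hn1 hn2
  have hsub : {ω | Z k n ω ∈ {y : M | dist x y < δ}} ⊆
      {ω | Y n ω ∈ U} ∪ {ω | δ₀ / 2 ≤ dist (Y n ω) (Z k n ω)} := by
    intro ω hω
    by_cases h : δ₀ / 2 ≤ dist (Y n ω) (Z k n ω)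
    · exact Or.inr h
    · left
      apply hball
      have hω' : dist x (Z k n ω) < δ := hω
      push Not at h
      have := dist_triangle_right (Y n ω) x (Z k n ω)
      rw [Metric.mem_ball]
      linarith
  have h4 := hk₀ k hkk n
  rw [neg_neg] at h4
  have h5 : ENNReal.ofReal (Real.exp (n * r)) + ENNReal.ofReal (Real.exp (n * r)) ≤
      P n {ω | Y n ω ∈ U} + ENNReal.ofReal (Real.exp (n * r)) := by
    rw [← two_mul]
    refine (hn2.trans hn1).trans ((measure_mono hsub).trans ((measure_union_le _ _).trans ?_))
    gcongr
  exact (ENNReal.add_le_add_iff_right ENNReal.ofReal_ne_top).1 h5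

theorem ExpApprox.satisfiesLDP [∀ n, IsProbabilityMeasure (P n)]
    (hZ : ∀ k, SatisfiesLDP P (Z k) (I k)) (happ : ExpApprox P Y Z) (ht : ExpTight P Y) :
    SatisfiesLDP P Y (limitRate I) :=
  ⟨fun _ hF => happ.upper_bound hZ ht hF, fun _ hU => happ.lower_bound hZ hU⟩

end ExponentialApproximation

/-! ### Large deviation estimates for the number of exceptional marks -/

section MarkEstimates

theorem measure_pi_forall_mem {ι α : Type*} [Fintype ι] [MeasurableSpace α]
    (μ : Measure α) [IsProbabilityMeasure μ] (N : Set α) (T : Finset ι) :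
    Measure.pi (fun _ : ι => μ) {x | ∀ i ∈ T, x i ∈ N} = μ N ^ T.card := by
  classical
  have : {x : ι → α | ∀ i ∈ T, x i ∈ N} = univ.pi fun i => if i ∈ T then N else univ := by
    ext x
    simp only [mem_ofPred_eq, mem_univ_pi]
    refine forall_congr' fun i => ?_
    by_cases hi : i ∈ T <;> simp [hi]
  rw [this, Measure.pi_pi]
  simp only [apply_ite μ, measure_univ]
  rw [Finset.prod_ite_mem]
  simp

theorem measurableSet_forall_mem {ι α : Type*} [MeasurableSpace α]
    {N : Set α} (hN : MeasurableSet N) (T : Finset ι) :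
    MeasurableSet {x : ι → α | ∀ i ∈ T, x i ∈ N} := by
  have : {x : ι → α | ∀ i ∈ T, x i ∈ N} = ⋂ i ∈ T, (fun x => x i) ⁻¹' N := by
    ext x; simp
  rw [this]
  exact Finset.measurableSet_biInter _ fun i _ => measurable_pi_apply i hN

/-- This allows events to be split according to the finitely many values of the random graph. -/
instance instMeasurableSingletonClassSimpleGraph {V : Type*} [Countable V] :
    MeasurableSingletonClass (SimpleGraph V) :=
  ⟨fun H => by
    have h := SimpleGraph.measurableEmbedding_edgeSet (V := V)
    have : ({H} : Set (SimpleGraph V)) = SimpleGraph.edgeSet ⁻¹' {H.edgeSet} := by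
      ext K; simp
    rw [this]
    exact h.measurable (measurableSet_singleton _)⟩

variable {Θ : Type u} {Ξ : Type w} [MeasurableSpace Θ] [MeasurableSpace Ξ]
  {ν : Measure Θ} [IsProbabilityMeasure ν] {χ : Measure (Ξ × Ξ)} [IsProbabilityMeasure χ]
  {n : ℕ} {Ω : Type*} [MeasurableSpace Ω] {P : Measure Ω}
  {G : Ω → SimpleGraph (Fin n)} {O : Ω → Fin n → Θ}
  {X : Ω → Sym2 (Fin n) → Ξ × Ξ} {C : Ω → Sym2 (Fin n) → Bool}

/-- The coins are integrated out: later estimates control both entries of `X e` together, so the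
order that the coin selects is irrelevant. -/
theorem IsIIDMarking.measure_inter (h : IsIIDMarking ν χ P G O X C)
    {A : Set (SimpleGraph (Fin n))} (hA : MeasurableSet A)
    {N : Set Θ} (hN : MeasurableSet N) {N' : Set (Ξ × Ξ)} (hN' : MeasurableSet N')
    (T : Finset (Fin n)) (T' : Finset (Sym2 (Fin n))) :
    P {ω | G ω ∈ A ∧ (∀ v ∈ T, O ω v ∈ N) ∧ ∀ e ∈ T', X ω e ∈ N'} =
      P {ω | G ω ∈ A} * (ν N ^ T.card * χ N' ^ T'.card) := by
  have hm : Measurable fun ω => (G ω, O ω, X ω, C ω) :=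
    h.measurable_graph.prodMk (h.measurable_vmark.prodMk
      (h.measurable_emark.prodMk h.measurable_coin))
  have h1 := congrArg (fun μ => μ (A ×ˢ ({x | ∀ v ∈ T, x v ∈ N} ×ˢ
    ({x | ∀ e ∈ T', x e ∈ N'} ×ˢ univ)))) h.law
  simp only [Measure.prod_prod, measure_pi_forall_mem, measure_univ, mul_one] at h1
  rw [Measure.map_apply hm (hA.prod ((measurableSet_forall_mem hN T).prod
    ((measurableSet_forall_mem hN' T').prod MeasurableSet.univ))),
    Measure.map_apply h.measurable_graph hA] at h1
  rw [← mul_assoc] at h1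
  rw [← mul_assoc]
  change _ = P (G ⁻¹' A) * _ * _
  rw [← h1]
  congr 1
  ext ω
  simp

theorem card_powersetCard_le_two_pow {α : Type*} (s : Finset α) (m : ℕ) :
    (s.powersetCard m).card ≤ 2 ^ s.card := by
  rw [← Finset.card_powerset]
  exact Finset.card_le_card fun t ht =>
    Finset.mem_powerset.2 (Finset.mem_powersetCard.1 ht).1

/-- Union bound over the at most 2^n sets of m vertices that could all carry marks in `N`. -/
theorem IsIIDMarking.measure_vmark_le [IsProbabilityMeasure P] (h : IsIIDMarking ν χ P G O X C)
    {N : Set Θ} (hN : MeasurableSet N) (m : ℕ) :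
    P {ω | m ≤ {v | O ω v ∈ N}.ncard} ≤ 2 ^ n * ν N ^ m := by
  classical
  have hsub : {ω | m ≤ {v | O ω v ∈ N}.ncard} ⊆
      ⋃ T ∈ (Finset.univ : Finset (Fin n)).powersetCard m, {ω | ∀ v ∈ T, O ω v ∈ N} := by
    intro ω hω
    have hω' : m ≤ {v | O ω v ∈ N}.ncard := hω
    rw [Set.ncard_eq_toFinset_card'] at hω'
    obtain ⟨T, hT, hTm⟩ := Finset.exists_subset_card_eq hω'
    refine mem_biUnion (x := T) (by simp [hTm]) fun v hv => ?_
    simpa using hT hv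
  refine (measure_mono hsub).trans ((measure_biUnion_finset_le _ _).trans ?_)
  have hT : ∀ T ∈ (Finset.univ : Finset (Fin n)).powersetCard m,
      P {ω | ∀ v ∈ T, O ω v ∈ N} = ν N ^ m := by
    intro T hT
    have := h.measure_inter MeasurableSet.univ hN MeasurableSet.univ T ∅
    simpa [(Finset.mem_powersetCard.1 hT).2] using this
  rw [Finset.sum_congr rfl hT, Finset.sum_const, nsmul_eq_mul]
  gcongr
  have := card_powersetCard_le_two_pow (Finset.univ : Finset (Fin n)) m
  rw [Finset.card_univ, Fintype.card_fin] at this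
  exact_mod_cast this

/-- The edge set is random, so the union bound is made separately for each value H of the graph: at
most 2^M subsets of its edges matter, and independence gives the factor P(G = H), which sums to at
most 1. -/
theorem IsIIDMarking.measure_emark_le [IsProbabilityMeasure P] (h : IsIIDMarking ν χ P G O X C)
    {N : Set (Ξ × Ξ)} (hN : MeasurableSet N) (m M : ℕ) :
    P {ω | (G ω).edgeSet.ncard ≤ M ∧ m ≤ {e ∈ (G ω).edgeSet | X ω e ∈ N}.ncard} ≤
      2 ^ M * χ N ^ m := by
  classical
  have hsub : {ω | (G ω).edgeSet.ncard ≤ M ∧ m ≤ {e ∈ (G ω).edgeSet | X ω e ∈ N}.ncard} ⊆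
      ⋃ H ∈ Finset.univ.filter (fun H : SimpleGraph (Fin n) => H.edgeSet.ncard ≤ M),
        ⋃ T ∈ H.edgeSet.toFinset.powersetCard m, {ω | G ω = H ∧ ∀ e ∈ T, X ω e ∈ N} := by
    intro ω hω
    obtain ⟨h1, h2⟩ := hω
    rw [Set.ncard_eq_toFinset_card'] at h2
    obtain ⟨T, hT, hTm⟩ := Finset.exists_subset_card_eq h2
    refine mem_biUnion (x := G ω) (by simpa using h1) ?_
    refine mem_biUnion (x := T) ?_ ⟨rfl, fun e he => ?_⟩
    · refine Finset.mem_coe.2 (Finset.mem_powersetCard.2 ?_)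
      refine ⟨fun e he => ?_, hTm⟩
      have := hT he
      simp only [Set.mem_toFinset, mem_ofPred_eq] at this
      simpa using this.1
    · have := hT he
      simp only [Set.mem_toFinset, mem_ofPred_eq] at this
      exact this.2
  refine (measure_mono hsub).trans ((measure_biUnion_finset_le _ _).trans ?_)
  have hH : ∀ H ∈ Finset.univ.filter (fun H : SimpleGraph (Fin n) => H.edgeSet.ncard ≤ M),
      P (⋃ T ∈ H.edgeSet.toFinset.powersetCard m, {ω | G ω = H ∧ ∀ e ∈ T, X ω e ∈ N}) ≤
        P {ω | G ω = H} * (2 ^ M * χ N ^ m) := by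
    intro H hH
    refine (measure_biUnion_finset_le _ _).trans ?_
    have hT : ∀ T ∈ H.edgeSet.toFinset.powersetCard m,
        P {ω | G ω = H ∧ ∀ e ∈ T, X ω e ∈ N} = P {ω | G ω = H} * χ N ^ m := by
      intro T hT
      have := h.measure_inter (measurableSet_singleton H) MeasurableSet.univ hN ∅ T
      simpa [(Finset.mem_powersetCard.1 hT).2] using this
    rw [Finset.sum_congr rfl hT, Finset.sum_const, nsmul_eq_mul, mul_left_comm]
    gcongr
    have h1 := card_powersetCard_le_two_pow H.edgeSet.toFinset m
    rw [← Set.ncard_eq_toFinset_card'] at h1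
    have h2 : 2 ^ H.edgeSet.ncard ≤ 2 ^ M :=
      Nat.pow_le_pow_right (by norm_num) (Finset.mem_filter.1 hH).2
    exact_mod_cast h1.trans h2
  refine (Finset.sum_le_sum hH).trans ?_
  rw [← Finset.sum_mul]
  refine mul_le_of_le_one_left zero_le ?_
  have h3 : ∀ H : SimpleGraph (Fin n), P {ω | G ω = H} = P.map G {H} := fun H => by
    rw [Measure.map_apply h.measurable_graph (measurableSet_singleton H)]; rfl
  have : IsProbabilityMeasure (P.map G) :=
    Measure.isProbabilityMeasure_map h.measurable_graph.aemeasurable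
  simp only [h3]
  rw [sum_measure_singleton]
  exact prob_le_one

end MarkEstimates

/-! ### Vertices with an exceptional neighborhood -/

section Counting

variable {V : Type} [Fintype V]

theorem mem_closedBall_comm {V : Type} {H : SimpleGraph V} {x y : V} {r : ℕ} :
    x ∈ closedBall H y r ↔ y ∈ closedBall H x r := by
  simp only [closedBall, mem_ofPred_eq, SimpleGraph.edist_comm]

theorem closedBall_trans {V : Type} {H : SimpleGraph V} {x y z : V} {r s : ℕ}
    (h : y ∈ closedBall H x r) (h' : z ∈ closedBall H y s) : z ∈ closedBall H x (r + s) := by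
  have h1 : H.edist x y ≤ (r : ℕ∞) := h
  have h2 : H.edist y z ≤ (s : ℕ∞) := h'
  show H.edist x z ≤ ((r + s : ℕ) : ℕ∞)
  push_cast
  exact SimpleGraph.edist_triangle.trans (add_le_add h1 h2)

/-- All centers within distance h of a fixed u lie within 2h of one another. If one of them has a
2h-ball of at most S vertices, this ball contains them all; hence each element of `D` spoils at most
S centers with small balls. The degree of u itself need not be bounded. -/
theorem ncard_exceptional_le (H : SimpleGraph V) (D : Set V) (h S : ℕ) :
    {v | S < (closedBall H v (h + h)).ncard ∨ ∃ u ∈ closedBall H v h, u ∈ D}.ncard ≤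
      {v | S < (closedBall H v (h + h)).ncard}.ncard + S * D.ncard := by
  classical
  let W : V → Set V := fun u => {v | (closedBall H v (h + h)).ncard ≤ S ∧ u ∈ closedBall H v h}
  have hW : ∀ u, (W u).ncard ≤ S := by
    intro u
    rcases (W u).eq_empty_or_nonempty with he | ⟨v, hv⟩
    · simp [he]
    · refine le_trans (Set.ncard_le_ncard (fun v' hv' => ?_) (Set.toFinite _)) hv.1
      exact closedBall_trans hv.2 (mem_closedBall_comm.1 hv'.2)
  have hsub : {v | S < (closedBall H v (h + h)).ncard ∨ ∃ u ∈ closedBall H v h, u ∈ D} ⊆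
      {v | S < (closedBall H v (h + h)).ncard} ∪ ⋃ u ∈ D.toFinset, W u := by
    intro v hv
    by_cases hS : S < (closedBall H v (h + h)).ncard
    · exact Or.inl hS
    · right
      obtain ⟨u, hu, huD⟩ := hv.resolve_left hS
      exact mem_biUnion (x := u) (by simpa using huD) ⟨not_lt.1 hS, hu⟩
  refine (Set.ncard_le_ncard hsub (Set.toFinite _)).trans ((Set.ncard_union_le _ _).trans ?_)
  gcongr
  calc (⋃ u ∈ D.toFinset, W u).ncard ≤ ∑ u ∈ D.toFinset, (W u).ncard :=
        Finset.set_ncard_biUnion_le _ _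
    _ ≤ ∑ u ∈ D.toFinset, S := Finset.sum_le_sum fun u _ => hW u
    _ = S * D.ncard := by rw [Finset.sum_const, smul_eq_mul, mul_comm, ncard_eq_toFinset_card']

theorem ncard_endpoints_le (E : Set (Sym2 V)) : {v | ∃ e ∈ E, v ∈ e}.ncard ≤ 2 * E.ncard := by
  classical
  have hsub : {v | ∃ e ∈ E, v ∈ e} ⊆ ⋃ e ∈ E.toFinset, {v | v ∈ e} := by
    rintro v ⟨e, he, hv⟩
    exact mem_biUnion (x := e) (by simpa using he) hv
  have h2 : ∀ e : Sym2 V, {v | v ∈ e}.ncard ≤ 2 := by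
    intro e
    induction e with
    | h x y =>
      have : {v | v ∈ s(x, y)} = {x, y} := by ext; simp
      rw [this]
      exact (Set.ncard_insert_le _ _).trans (by simp)
  calc _ ≤ (⋃ e ∈ E.toFinset, {v | v ∈ e}).ncard := Set.ncard_le_ncard hsub (Set.toFinite _)
    _ ≤ ∑ e ∈ E.toFinset, {v | v ∈ e}.ncard := Finset.set_ncard_biUnion_le _ _
    _ ≤ ∑ e ∈ E.toFinset, 2 := Finset.sum_le_sum fun e _ => h2 e
    _ = 2 * E.ncard := by rw [Finset.sum_const, smul_eq_mul, mul_comm, ncard_eq_toFinset_card']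

end Counting

/-! ### Uniform consequences of sparsity -/

section Sparsity

variable {Ω : ℕ+ → Type*} [∀ n, MeasurableSpace (Ω n)] {P : ∀ n, Measure (Ω n)}
  {G : ∀ n : ℕ+, Ω n → SimpleGraph (Fin n)}

/-- The rate is monotone in the radius, so the limsup over radii being -∞ forces it at every fixed
radius. -/
theorem Sparse.exists_ball_bound (hs : Sparse P G) (h : ℕ) {ε : ℝ} (hε : 0 < ε) (c : ℝ) :
    ∃ S : ℕ, 1 ≤ S ∧ ∀ n : ℕ+,
      P n {ω | ε * ((n : ℕ) : ℝ) < ({v : Fin n | S < (closedBall (G n ω) v h).ncard}.ncard : ℝ)} ≤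
        ENNReal.ofReal (Real.exp (n * -c)) := by
  set f : ℕ → ℕ → EReal := fun h S => limsup (fun n : ℕ+ =>
      ENNReal.log (P n {ω | ε <
          ({v : Fin n | S < (closedBall (G n ω) v h).ncard}.ncard : ℝ) / ((n : ℕ) : ℝ)})
        / ((n : ℕ) : EReal)) atTop
  have hmono : ∀ h' ≥ h, ∀ S, f h S ≤ f h' S := by
    intro h' hh S
    refine limsup_le_limsup (Eventually.of_forall fun n => ?_)
    have hn : (0 : EReal) ≤ ((n : ℕ) : EReal) := by exact_mod_cast n.pos.le
    refine EReal.div_le_div_right_of_nonneg hn (ENNReal.log_le_log (measure_mono fun ω hω => ?_))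
    refine lt_of_lt_of_le (show ε < _ from hω) ?_
    gcongr
    · exact Set.toFinite _
    · exact Set.toFinite _
    · exact closedBall_mono _ _ hh
  have hbot : limsup (fun S => f h S) atTop = ⊥ := by
    refine le_bot_iff.1 ((hs.1 ε hε).le.trans' ?_)
    refine le_limsup_of_frequently_le (Eventually.frequently ?_) (by isBoundedDefault)
    filter_upwards [eventually_ge_atTop h] with h' hh
    exact limsup_le_limsup (Eventually.of_forall fun S => hmono h' hh S)
  have hlt : limsup (fun S => f h S) atTop < ((-c : ℝ) : EReal) := by
    rw [hbot]; exact EReal.bot_lt_coe _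
  obtain ⟨S, hS⟩ := (eventually_lt_of_limsup_lt hlt).exists
  obtain ⟨N, hN⟩ := eventually_atTop.1 (eventually_le_exp_of_limsup_lt hS)
  -- Raising the threshold to N makes the event empty for n < N, because a ball has at most n
  -- vertices; the bound then holds for every n.
  refine ⟨max S N, le_max_of_le_right N.pos, fun n => ?_⟩
  have hn0 : (0 : ℝ) < ((n : ℕ) : ℝ) := by exact_mod_cast n.pos
  rcases le_or_gt N n with hn | hn
  · refine (measure_mono fun ω hω => ?_).trans (hN n hn)
    have hω' : ε * ((n : ℕ) : ℝ) < _ := hω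
    show ε < _ / _
    rw [lt_div_iff₀ hn0]
    refine hω'.trans_le ?_
    exact_mod_cast Set.ncard_le_ncard
      (fun v hv => (le_max_left S N).trans_lt (show max S (N : ℕ) < _ from hv)) (Set.toFinite _)
  · have : {ω | ε * ((n : ℕ) : ℝ) < ({v : Fin n | max S (N : ℕ) <
        (closedBall (G n ω) v h).ncard}.ncard : ℝ)} = ∅ := by
      refine Set.eq_empty_iff_forall_notMem.2 fun ω hω => ?_
      have he : {v : Fin n | max S (N : ℕ) < (closedBall (G n ω) v h).ncard} = ∅ := by
        refine Set.eq_empty_iff_forall_notMem.2 fun v hv => ?_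
        have h1 : max S (N : ℕ) < (closedBall (G n ω) v h).ncard := hv
        have h2 : (closedBall (G n ω) v h).ncard ≤ n := by
          simpa using Set.ncard_le_card (closedBall (G n ω) v h)
        have h3 : (n : ℕ) < N := hn
        have h4 := le_max_right S (N : ℕ)
        omega
      have hω' : ε * ((n : ℕ) : ℝ) < _ := hω
      rw [he, Set.ncard_empty, Nat.cast_zero] at hω'
      have : 0 < ε * ((n : ℕ) : ℝ) := by positivity
      linarith
    rw [this, measure_empty]
    exact zero_le

theorem Sparse.exists_edge_bound (hs : Sparse P G) (c : ℝ) :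
    ∃ a : ℕ, ∀ n : ℕ+, P n {ω | a * (n : ℕ) ≤ (G n ω).edgeSet.ncard} ≤
        ENNReal.ofReal (Real.exp (n * -c)) := by
  have hlt := hs.2.trans_lt (EReal.bot_lt_coe (-c))
  obtain ⟨a, ha⟩ := (eventually_lt_of_limsup_lt hlt).exists
  obtain ⟨N, hN⟩ := eventually_atTop.1 (eventually_le_exp_of_limsup_lt ha)
  -- The summand N excludes n < N, where there are at most n² < Nn edges.
  refine ⟨⌈a⌉₊ + N, fun n => ?_⟩
  have hn0 : 0 < (n : ℕ) := n.pos
  rcases le_or_gt N n with hn | hn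
  · refine (measure_mono fun ω hω => ?_).trans (hN n hn)
    have hω' : (⌈a⌉₊ + (N : ℕ)) * (n : ℕ) ≤ _ := hω
    show a * ((n : ℕ) : ℝ) ≤ _
    have h1 : a * ((n : ℕ) : ℝ) ≤ ((⌈a⌉₊ + (N : ℕ) : ℕ) : ℝ) * ((n : ℕ) : ℝ) := by
      gcongr
      push_cast
      exact (Nat.le_ceil a).trans (by simp)
    exact h1.trans (by exact_mod_cast hω')
  · have : {ω | (⌈a⌉₊ + (N : ℕ)) * (n : ℕ) ≤ (G n ω).edgeSet.ncard} = ∅ := by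
      classical
      refine Set.eq_empty_iff_forall_notMem.2 fun ω hω => ?_
      have hω' : (⌈a⌉₊ + (N : ℕ)) * (n : ℕ) ≤ _ := hω
      have h1 : (G n ω).edgeSet.ncard ≤ (n : ℕ) ^ 2 := by
        have := (G n ω).card_edgeFinset_le_card_choose_two
        rw [Fintype.card_fin, SimpleGraph.edgeFinset, ← Set.ncard_eq_toFinset_card'] at this
        exact this.trans (Nat.choose_le_pow _ _)
      have h3 : (n : ℕ) < N := hn
      nlinarith
    rw [this, measure_empty]
    exact zero_le

/-- The endpoints of exceptional edges and the vertices with an exceptional mark. -/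
def exceptionalVertices {Θ : Type u} {Ξ : Type w} {n : ℕ} (N : Set Θ) (N' : Set (Ξ × Ξ))
    (H : SimpleGraph (Fin n)) (o : Fin n → Θ) (x : Sym2 (Fin n) → Ξ × Ξ) : Set (Fin n) :=
  {v | o v ∈ N} ∪ {v | ∃ e ∈ {e ∈ H.edgeSet | x e ∈ N'}, v ∈ e}

/-- The vertices with a large ball of radius `2 * h`, or with an exceptional vertex in the ball
of radius `h`. -/
def exceptionalCenters {n : ℕ} (H : SimpleGraph (Fin n)) (D : Set (Fin n)) (h S : ℕ) :
    Set (Fin n) :=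
  {v | S < (closedBall H v (h + h)).ncard ∨ ∃ u ∈ closedBall H v h, u ∈ D}

theorem four_mul_exp_le (n : ℕ+) (c : ℝ) :
    4 * ENNReal.ofReal (Real.exp (n * -(c + 2))) ≤ ENNReal.ofReal (Real.exp (n * -c)) := by
  have h4 : (4 : ℝ≥0∞) = ENNReal.ofReal 4 := by simp
  rw [h4, ← ENNReal.ofReal_mul (by norm_num)]
  apply ENNReal.ofReal_le_ofReal
  have hn : (1 : ℝ) ≤ ((n : ℕ) : ℝ) := by exact_mod_cast n.pos
  have h1 : (4 : ℝ) ≤ Real.exp 2 := by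
    have h2 := Real.add_one_le_exp (1 : ℝ)
    have h3 : Real.exp 2 = Real.exp 1 * Real.exp 1 := by rw [← Real.exp_add]; norm_num
    nlinarith
  calc 4 * Real.exp (n * -(c + 2)) ≤ Real.exp (2 * n) * Real.exp (n * -(c + 2)) := by
        gcongr
        exact h1.trans (Real.exp_le_exp.2 (by linarith))
    _ = Real.exp (n * -c) := by rw [← Real.exp_add]; ring_nf

/-- The choice of p gives p^m ≤ e^{-(c+a)n}, and e^{an} of this pays for the 2^{an} subsets. -/
theorem two_pow_mul_pow_le {p : ℝ≥0∞} {c η : ℝ} {a n m : ℕ} (hη : 0 < η)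
    (hp : p ≤ ENNReal.ofReal (Real.exp (-((c + a) / η)))) (hca : 0 ≤ c + a) (hm : η * n ≤ m) :
    2 ^ (a * n) * p ^ m ≤ ENNReal.ofReal (Real.exp (n * -c)) := by
  have h2 : (2 : ℝ≥0∞) = ENNReal.ofReal 2 := by simp
  calc 2 ^ (a * n) * p ^ m
      ≤ ENNReal.ofReal 2 ^ (a * n) * ENNReal.ofReal (Real.exp (-((c + a) / η))) ^ m := by
        rw [← h2]; gcongr
    _ = ENNReal.ofReal (2 ^ (a * n) * Real.exp (-((c + a) / η)) ^ m) := by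
        rw [← ENNReal.ofReal_pow (by norm_num), ← ENNReal.ofReal_pow (by positivity),
          ← ENNReal.ofReal_mul (by positivity)]
    _ ≤ ENNReal.ofReal (Real.exp (n * -c)) := by
        apply ENNReal.ofReal_le_ofReal
        have h3 : (2 : ℝ) ^ (a * n) ≤ Real.exp (a * n) := by
          have := Real.add_one_le_exp (1 : ℝ)
          calc (2 : ℝ) ^ (a * n) ≤ Real.exp 1 ^ (a * n) := by
                gcongr; linarith
            _ = Real.exp (a * n) := by rw [← Real.exp_nat_mul]; simp
        have h4 : Real.exp (-((c + a) / η)) ^ m ≤ Real.exp (-((c + a) * n)) := by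
          rw [← Real.exp_nat_mul, Real.exp_le_exp]
          have : (c + a) * n ≤ m * ((c + a) / η) := by
            rw [← mul_div_assoc, le_div_iff₀ hη]
            nlinarith
          linarith
        calc _ ≤ Real.exp (a * n) * Real.exp (-((c + a) * n)) := by gcongr
          _ = Real.exp (n * -c) := by rw [← Real.exp_add]; ring_nf

/-- With overwhelming probability only few vertices are exceptional, provided that the
exceptional marks have small probability. -/
theorem Sparse.exists_exceptional_bound {Θ : Type u} {Ξ : Type w}
    [MeasurableSpace Θ] [MeasurableSpace Ξ]
    {ν : Measure Θ} [IsProbabilityMeasure ν] {χ : Measure (Ξ × Ξ)} [IsProbabilityMeasure χ]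
    [∀ n, IsProbabilityMeasure (P n)]
    {O : ∀ n : ℕ+, Ω n → Fin n → Θ} {X : ∀ n : ℕ+, Ω n → Sym2 (Fin n) → Ξ × Ξ}
    {C : ∀ n : ℕ+, Ω n → Sym2 (Fin n) → Bool}
    (hs : Sparse P G) (hmarks : ∀ n, IsIIDMarking ν χ (P n) (G n) (O n) (X n) (C n))
    (h : ℕ) {ε : ℝ} (hε : 0 < ε) (c : ℝ) :
    ∃ (S : ℕ) (p : ℝ≥0∞), 0 < p ∧ ∀ (N : Set Θ) (N' : Set (Ξ × Ξ)),
      MeasurableSet N → MeasurableSet N' → ν N ≤ p → χ N' ≤ p → ∀ n : ℕ+,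
        P n {ω | ε * ((n : ℕ) : ℝ) < ((exceptionalCenters (G n ω)
          (exceptionalVertices N N' (G n ω) (O n ω) (X n ω)) h S).ncard : ℝ)} ≤
        ENNReal.ofReal (Real.exp (n * -c)) := by
  wlog hc : 0 ≤ c generalizing c
  · obtain ⟨S, p, hp, hall⟩ := this 0 le_rfl
    refine ⟨S, p, hp, fun N N' hN hN' h1 h2 n => (hall N N' hN hN' h1 h2 n).trans ?_⟩
    apply ENNReal.ofReal_le_ofReal
    rw [Real.exp_le_exp]
    have : (0 : ℝ) ≤ ((n : ℕ) : ℝ) := by positivity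
    nlinarith
  -- Four bad events will be added up, and the extra 2 in the rate absorbs them because 4 ≤ e².
  obtain ⟨S, hS1, hS⟩ := hs.exists_ball_bound (h + h) (half_pos hε) (c + 2)
  obtain ⟨a, ha⟩ := hs.exists_edge_bound (c + 2)
  have hS0 : (0 : ℝ) < S := by exact_mod_cast hS1
  -- Fewer than ηn bad vertex marks and ηn bad edges give at most 3ηn exceptional vertices, which
  -- spoil at most 3Sηn = (3/8)εn centers; with the (ε/2)n large balls this stays below εn.
  set η : ℝ := ε / (8 * S) with hη
  have hη0 : 0 < η := by positivity
  refine ⟨S, min (ENNReal.ofReal (Real.exp (-((c + 2 + (1 : ℕ)) / η))))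
    (ENNReal.ofReal (Real.exp (-((c + 2 + a) / η)))), ?_, ?_⟩
  · exact lt_min (ENNReal.ofReal_pos.2 (Real.exp_pos _)) (ENNReal.ofReal_pos.2 (Real.exp_pos _))
  intro N N' hN hN' hνN hχN n
  set m : ℕ := ⌈η * ((n : ℕ) : ℝ)⌉₊
  have hmn : η * ((n : ℕ) : ℝ) ≤ m := Nat.le_ceil _
  have e1 := hS n
  have e2 := ha n
  have e3' := two_pow_mul_pow_le (n := (n : ℕ)) (m := m) hη0 (hνN.trans (min_le_left _ _))
    (by positivity) hmn
  rw [one_mul] at e3'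
  have e3 := ((hmarks n).measure_vmark_le hN m).trans e3'
  have e4 := ((hmarks n).measure_emark_le hN' m (a * n)).trans
    (two_pow_mul_pow_le hη0 (hχN.trans (min_le_right _ _)) (by positivity) hmn)
  refine le_trans ?_ (four_mul_exp_le n c)
  set B1 := {ω | ε / 2 * ((n : ℕ) : ℝ) <
    ({v : Fin n | S < (closedBall (G n ω) v (h + h)).ncard}.ncard : ℝ)}
  set B2 := {ω | a * (n : ℕ) ≤ (G n ω).edgeSet.ncard}
  set B3 := {ω | m ≤ {v | O n ω v ∈ N}.ncard}
  set B4 := {ω | (G n ω).edgeSet.ncard ≤ a * n ∧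
    m ≤ {e ∈ (G n ω).edgeSet | X n ω e ∈ N'}.ncard}
  have hsub : {ω | ε * ((n : ℕ) : ℝ) < ((exceptionalCenters (G n ω)
      (exceptionalVertices N N' (G n ω) (O n ω) (X n ω)) h S).ncard : ℝ)} ⊆
      (B1 ∪ B2) ∪ (B3 ∪ B4) := by
    intro ω hω
    by_contra hcon
    simp only [mem_union, not_or] at hcon
    obtain ⟨⟨h1, h2⟩, h3, h4⟩ := hcon
    have h1' : ({v : Fin n | S < (closedBall (G n ω) v (h + h)).ncard}.ncard : ℝ) ≤
      ε / 2 * ((n : ℕ) : ℝ) := not_lt.1 h1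
    have h2' : (G n ω).edgeSet.ncard ≤ a * n := (not_le.1 h2).le
    have h3' : {v | O n ω v ∈ N}.ncard < m := not_le.1 h3
    have h4' : {e ∈ (G n ω).edgeSet | X n ω e ∈ N'}.ncard < m :=
      not_le.1 fun hle => h4 ⟨h2', hle⟩
    have h5 := Nat.lt_ceil.1 h3'
    have h6 := Nat.lt_ceil.1 h4'
    have h7 := ncard_exceptional_le (G n ω)
      (exceptionalVertices N N' (G n ω) (O n ω) (X n ω)) h S
    have h8 : (exceptionalVertices N N' (G n ω) (O n ω) (X n ω)).ncard ≤
        {v | O n ω v ∈ N}.ncard + 2 * {e ∈ (G n ω).edgeSet | X n ω e ∈ N'}.ncard :=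
      (Set.ncard_union_le _ _).trans (add_le_add_right (ncard_endpoints_le _) _)
    have hω' : ε * ((n : ℕ) : ℝ) < (({v | S < (closedBall (G n ω) v (h + h)).ncard ∨
      ∃ u ∈ closedBall (G n ω) v h,
        u ∈ exceptionalVertices N N' (G n ω) (O n ω) (X n ω)}.ncard : ℕ) : ℝ) := hω
    have h7' := (Nat.cast_le (α := ℝ)).2 h7
    have h8' := (Nat.cast_le (α := ℝ)).2 h8
    push_cast at h7' h8'
    have h9 : (S : ℝ) * ((exceptionalVertices N N' (G n ω) (O n ω) (X n ω)).ncard : ℝ) ≤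
        S * (3 * (η * ((n : ℕ) : ℝ))) := by gcongr; linarith
    have h10 : (S : ℝ) * (3 * (η * ((n : ℕ) : ℝ))) = 3 / 8 * (ε * ((n : ℕ) : ℝ)) := by
      rw [hη]; field_simp
    have : 0 < ε * ((n : ℕ) : ℝ) := by
      have : (0 : ℝ) < ((n : ℕ) : ℝ) := by exact_mod_cast n.pos
      positivity
    linarith
  calc _ ≤ P n ((B1 ∪ B2) ∪ (B3 ∪ B4)) := measure_mono hsub
    _ ≤ (P n B1 + P n B2) + (P n B3 + P n B4) :=
      (measure_union_le _ _).trans (add_le_add (measure_union_le _ _) (measure_union_le _ _))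
    _ ≤ _ := add_le_add (add_le_add e1 e2) (add_le_add e3 e4)
    _ = 4 * ENNReal.ofReal (Real.exp (n * -(c + 2))) := by ring

end Sparsity

/-! ### Balls in rooted graphs -/

theorem mem_closedBall_succ_of_adj {V : Type} {H : SimpleGraph V} {o x y : V} {s : ℕ}
    (hx : x ∈ closedBall H o s) (h : H.Adj x y) : y ∈ closedBall H o (s + 1) := by
  refine closedBall_trans hx ?_
  show H.edist x y ≤ ((1 : ℕ) : ℕ∞)
  rw [SimpleGraph.edist_eq_one_iff_adj.2 h]
  exact le_rfl

theorem mem_closedBall_zero {V : Type} {H : SimpleGraph V} {o x : V} :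
    x ∈ closedBall H o 0 ↔ x = o := by
  show H.edist o x ≤ ((0 : ℕ) : ℕ∞) ↔ _
  rw [Nat.cast_zero, nonpos_iff_eq_zero, SimpleGraph.edist_eq_zero_iff, eq_comm]

theorem mem_closedBall_succ {V : Type} {H : SimpleGraph V} {o y : V} {s : ℕ} :
    y ∈ closedBall H o (s + 1) ↔ y = o ∨ ∃ x ∈ closedBall H o s, H.Adj x y := by
  constructor
  · exact fun h => RootedMarkedGraph.exists_pred H o y s h
  · rintro (rfl | ⟨x, hx, h⟩)
    · exact self_mem_closedBall _ _ _
    · exact mem_closedBall_succ_of_adj hx h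

theorem finite_closedBall {V : Type} {H : SimpleGraph V} (hH : ∀ v, (H.neighborSet v).Finite)
    (o : V) (s : ℕ) : (closedBall H o s).Finite := by
  induction s with
  | zero => exact (Set.finite_singleton o).subset fun x hx => mem_closedBall_zero.1 hx
  | succ s ih =>
    refine ((ih.biUnion fun x _ => hH x).insert o).subset fun y hy => ?_
    rcases mem_closedBall_succ.1 hy with h | ⟨x, hx, h⟩
    · exact Or.inl h
    · exact Or.inr (mem_biUnion hx h)

namespace RootedMarkedGraph

variable {Θ : Type u} {Ξ : Type w}

theorem finite_ball (a : RootedMarkedGraph Θ Ξ) (s : ℕ) : (a.ball s).Finite :=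
  finite_closedBall a.locallyFinite _ _

theorem exists_mem_ball (a : RootedMarkedGraph Θ Ξ) (x : a.V) : ∃ s, x ∈ a.ball s := by
  have h := (SimpleGraph.edist_ne_top_iff_reachable (G := a.toMarked.graph)).2
    (a.connected.preconnected a.root x)
  obtain ⟨s, hs⟩ := ENat.ne_top_iff_exists.1 h
  exact ⟨s, hs.ge⟩

theorem exists_rel_of_mem_ball {a b : RootedMarkedGraph Θ Ξ} {r : ℕ} {R : a.V → b.V → Prop}
    (h0 : R a.root b.root)
    (hfw : ∀ s < r, ∀ x ∈ a.ball s, ∀ y ∈ b.ball s, R x y → ∀ x', a.toMarked.graph.Adj x x' →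
      ∃ y', R x' y' ∧ b.toMarked.graph.Adj y y') :
    ∀ s ≤ r, ∀ x ∈ a.ball s, ∃ y ∈ b.ball s, R x y := by
  intro s
  induction s with
  | zero =>
    intro _ x hx
    rw [mem_closedBall_zero.1 hx]
    exact ⟨b.root, self_mem_closedBall _ _ _, h0⟩
  | succ s ih =>
    intro hs x hx
    rcases mem_closedBall_succ.1 hx with h | ⟨z, hz, h⟩
    · rw [h]
      exact ⟨b.root, self_mem_closedBall _ _ _, h0⟩
    · obtain ⟨y, hy, hzy⟩ := ih (by omega) z hz
      obtain ⟨y', hy', hadj⟩ := hfw s (by omega) z hz y hy hzy x h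
      exact ⟨y', mem_closedBall_succ_of_adj hy hadj, hy'⟩

/-- A partial correspondence between the vertices of two rooted graphs that respects the edges
near the roots and almost respects the marks shows that the graphs are close. -/
theorem isGood_of_rel [MetricSpace Θ] [MetricSpace Ξ] {a b : RootedMarkedGraph Θ Ξ}
    {r : ℕ} {δ : ℝ} (R : a.V → b.V → Prop) (h0 : R a.root b.root)
    (hfun : ∀ x y y', R x y → R x y' → y = y') (hinj : ∀ x x' y, R x y → R x' y → x = x')
    (hfw : ∀ s < r, ∀ x ∈ a.ball s, ∀ y ∈ b.ball s, R x y → ∀ x', a.toMarked.graph.Adj x x' →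
      ∃ y', R x' y' ∧ b.toMarked.graph.Adj y y')
    (hbw : ∀ s < r, ∀ y ∈ b.ball s, ∀ x ∈ a.ball s, R x y → ∀ y', b.toMarked.graph.Adj y y' →
      ∃ x', R x' y' ∧ a.toMarked.graph.Adj x x')
    (hadj : ∀ x ∈ a.ball r, ∀ x' ∈ a.ball r, ∀ y ∈ b.ball r, ∀ y' ∈ b.ball r, R x y → R x' y' →
      (a.toMarked.graph.Adj x x' ↔ b.toMarked.graph.Adj y y'))
    (hv : ∀ x ∈ a.ball r, ∀ y ∈ b.ball r, R x y →
      dist (a.toMarked.vmark x) (b.toMarked.vmark y) < δ)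
    (he : ∀ x ∈ a.ball r, ∀ x' ∈ a.ball r, ∀ y ∈ b.ball r, ∀ y' ∈ b.ball r, R x y → R x' y' →
      ∀ (h : a.toMarked.graph.Adj x x') (h' : b.toMarked.graph.Adj y y'),
      dist (a.toMarked.emark x x' h) (b.toMarked.emark y y' h') < δ) :
    IsGood a b r δ := by
  have hf := exists_rel_of_mem_ball h0 hfw r le_rfl
  have hg := exists_rel_of_mem_ball (a := b) (b := a) (R := fun y x => R x y) h0 hbw r le_rfl
  have : Nonempty a.V := ⟨a.root⟩
  have : Nonempty b.V := ⟨b.root⟩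
  choose! f hfb hfR using hf
  choose! g hgb hgR using hg
  let φ : a.ballGraph r ≃g b.ballGraph r :=
    { toFun := fun x => ⟨f x, hfb x x.2⟩
      invFun := fun y => ⟨g y, hgb y y.2⟩
      left_inv := fun x => Subtype.ext
        (hinj _ _ (f x) (hgR (f x) (hfb x x.2)) (hfR x x.2))
      right_inv := fun y => Subtype.ext
        (hfun (g y) _ _ (hfR (g y) (hgb y y.2)) (hgR y y.2))
      map_rel_iff' := fun {x x'} =>
        (hadj x x.2 x' x'.2 (f x) (hfb x x.2) (f x') (hfb x' x'.2)
          (hfR x x.2) (hfR x' x'.2)).symm }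
  refine ⟨φ, ?_, ?_, ?_⟩
  · exact hfun a.root _ _ (hfR a.root (self_mem_closedBall _ _ _)) h0
  · exact fun v => hv v v.2 _ (φ v).2 (hfR v v.2)
  · exact fun x y h => he x x.2 y y.2 _ (φ x).2 _ (φ y).2 (hfR x x.2) (hfR y y.2) h _

theorem repDist_le_of_isGood [MetricSpace Θ] [MetricSpace Ξ] {a b : RootedMarkedGraph Θ Ξ}
    {r : ℕ} {δ : ℝ} (hδ : 0 < δ) (h : IsGood a b r δ) :
    repDist a b ≤ 1 / (1 + (r : ℝ)) + δ :=
  csInf_le (repDist_bddBelow a b) ⟨r, δ, hδ, h, rfl⟩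

/-- The connected component of a vertex of a locally finite marked graph. -/
def component {V : Type} (G : MarkedGraph V Θ Ξ) (hG : ∀ v, (G.graph.neighborSet v).Finite)
    (v : V) : RootedMarkedGraph Θ Ξ where
  V := (G.graph.connectedComponentMk v).supp
  toMarked :=
    { graph := G.graph.induce (G.graph.connectedComponentMk v).supp
      vmark := fun x => G.vmark x
      emark := fun x y h => G.emark x y h }
  root := ⟨v, rfl⟩
  connected := (G.graph.connectedComponentMk v).connected_toSimpleGraph
  locallyFinite := fun x => by
    refine Set.Finite.of_finite_image ((hG x).subset ?_) Subtype.val_injective.injOn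
    rintro _ ⟨y, hy, rfl⟩
    exact hy

theorem mem_supp_of_adj {V : Type} {H : SimpleGraph V} {v x y : V}
    (hx : x ∈ (H.connectedComponentMk v).supp) (h : H.Adj x y) :
    y ∈ (H.connectedComponentMk v).supp := by
  rw [SimpleGraph.ConnectedComponent.mem_supp_iff] at hx ⊢
  rw [← hx]
  exact SimpleGraph.ConnectedComponent.sound h.symm.reachable

theorem mem_ball_component {V : Type} {G : MarkedGraph V Θ Ξ}
    {hG : ∀ v, (G.graph.neighborSet v).Finite} {v : V} {s : ℕ} (x : (component G hG v).V) :
    x ∈ (component G hG v).ball s ↔ x.1 ∈ closedBall G.graph v s := by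
  induction s generalizing x with
  | zero =>
    refine mem_closedBall_zero.trans (Iff.trans ?_ mem_closedBall_zero.symm)
    exact Subtype.ext_iff
  | succ s ih =>
    refine mem_closedBall_succ.trans (Iff.trans ?_ mem_closedBall_succ.symm)
    refine or_congr Subtype.ext_iff ⟨?_, ?_⟩
    · rintro ⟨y, hy, h⟩
      exact ⟨y.1, (ih y).1 hy, h⟩
    · rintro ⟨y, hy, h⟩
      exact ⟨⟨y, mem_supp_of_adj x.2 h.symm⟩, (ih _).2 hy, h⟩

end RootedMarkedGraph

/-! ### Separability of the space of rooted marked graphs -/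

section Separable

theorem GStar.exists_mk {Θ : Type u} {Ξ : Type w} (x : GStar Θ Ξ) : ∃ a, GStar.mk a = x := Quotient.exists_rep x

variable {Θ : Type u} {Ξ : Type w} [MetricSpace Θ] [MetricSpace Ξ]

theorem GStar.dist_mk (a b : RootedMarkedGraph Θ Ξ) :
    dist (GStar.mk a) (GStar.mk b) = RootedMarkedGraph.repDist a b := rfl

/-- Finite graphs with marks in two sequences. -/
def finiteModel (θ : ℕ → Θ) (ξ : ℕ → Ξ)
    (d : Σ n : ℕ, SimpleGraph (Fin n) × Fin n × (Fin n → ℕ) × (Fin n → Fin n → ℕ)) :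
    GStar Θ Ξ :=
  GStar.mk ((⟨d.2.1, fun v => θ (d.2.2.2.1 v), fun x y _ => ξ (d.2.2.2.2 x y)⟩ :
    MarkedGraph (Fin d.1) Θ Ξ).rootedComponent d.2.2.1)

/-- Up to 1/(1+r) the local metric sees only the finite ball of radius r, whose marks can be moved
to the dense sequences. -/
theorem denseRange_finiteModel {θ : ℕ → Θ} {ξ : ℕ → Ξ} (hθ : DenseRange θ) (hξ : DenseRange ξ) :
    DenseRange (finiteModel θ ξ) := by
  rw [Metric.denseRange_iff]
  intro x ε hε
  obtain ⟨a, rfl⟩ := GStar.exists_mk x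
  obtain ⟨r, hr⟩ := exists_nat_one_div_lt (half_pos hε)
  rw [add_comm] at hr
  have hfin := a.finite_ball r
  have : Finite (a.ball r) := hfin
  obtain ⟨n, ⟨e⟩⟩ := Finite.exists_equiv_fin (a.ball r)
  have hθ' : ∀ t : Θ, ∃ i, dist t (θ i) < ε / 2 := fun t =>
    Metric.denseRange_iff.1 hθ t _ (half_pos hε)
  have hξ' : ∀ t : Ξ, ∃ i, dist t (ξ i) < ε / 2 := fun t =>
    Metric.denseRange_iff.1 hξ t _ (half_pos hε)
  choose i hi using hθ'
  choose j hj using hξ'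
  classical
  let H : SimpleGraph (Fin n) := (a.ballGraph r).map e.toEmbedding
  have hH : ∀ p q : a.ball r, H.Adj (e p) (e q) ↔ a.toMarked.graph.Adj p q := fun p q =>
    SimpleGraph.map_adj_apply
  let d : Σ n : ℕ, SimpleGraph (Fin n) × Fin n × (Fin n → ℕ) × (Fin n → Fin n → ℕ) :=
    ⟨n, H, e ⟨a.root, self_mem_closedBall _ _ _⟩, fun v => i (a.toMarked.vmark (e.symm v)),
      fun p q => if h : a.toMarked.graph.Adj (e.symm p) (e.symm q) then
        j (a.toMarked.emark _ _ h) else 0⟩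
  refine ⟨d, ?_⟩
  refine (RootedMarkedGraph.repDist_le_of_isGood (half_pos hε) ?_).trans_lt
    (b := 1 / (1 + (r : ℝ)) + ε / 2) (by linarith)
  -- The relation links a vertex of the ball to its number; it need not be shown that the component
  -- of the root contains all numbers.
  refine RootedMarkedGraph.isGood_of_rel
    (fun x y => ∃ h : x ∈ a.ball r, e ⟨x, h⟩ = y.1) ⟨self_mem_closedBall _ _ _, rfl⟩
    ?_ ?_ ?_ ?_ ?_ ?_ ?_
  · rintro x y y' ⟨h, hy⟩ ⟨_, hy'⟩
    exact Subtype.ext (hy.symm.trans hy')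
  · rintro x x' y ⟨h, hy⟩ ⟨h', hy'⟩
    exact congrArg Subtype.val (e.injective (hy.trans hy'.symm))
  · rintro s hs x hx y hy ⟨h, hxy⟩ x' hadj
    have hx' : x' ∈ a.ball r := closedBall_mono _ _ (by omega : s + 1 ≤ r)
      (mem_closedBall_succ_of_adj hx hadj)
    have hadj' : H.Adj y.1 (e ⟨x', hx'⟩) := by rw [← hxy]; exact (hH _ _).2 hadj
    exact ⟨⟨e ⟨x', hx'⟩, RootedMarkedGraph.mem_supp_of_adj y.2 hadj'⟩, ⟨hx', rfl⟩, hadj'⟩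
  · rintro s hs y hy x hx ⟨h, hxy⟩ y' hadj
    refine ⟨e.symm y'.1, ⟨(e.symm y'.1).2, by simp⟩, ?_⟩
    have hadj' : H.Adj y.1 y'.1 := hadj
    rw [← hxy, ← e.apply_symm_apply y'.1] at hadj'
    exact (hH _ _).1 hadj'
  · rintro x hx x' hx' y hy y' hy' ⟨h, hxy⟩ ⟨h', hxy'⟩
    have : H.Adj y.1 y'.1 ↔ a.toMarked.graph.Adj x x' := by
      rw [← hxy, ← hxy']; exact hH _ _
    exact this.symm
  · rintro x hx y hy ⟨h, hxy⟩
    have h1 : e.symm y.1 = ⟨x, h⟩ := by rw [← hxy, e.symm_apply_apply]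
    have := hi (a.toMarked.vmark x)
    show dist _ (θ (i (a.toMarked.vmark (e.symm y.1)))) < _
    rwa [h1]
  · rintro x hx x' hx' y hy y' hy' ⟨h, hxy⟩ ⟨h', hxy'⟩ hadj hadj'
    have h1 : e.symm y.1 = ⟨x, h⟩ := by rw [← hxy, e.symm_apply_apply]
    have h2 : e.symm y'.1 = ⟨x', h'⟩ := by rw [← hxy', e.symm_apply_apply]
    have h3 : a.toMarked.graph.Adj (e.symm y.1) (e.symm y'.1) := by rw [h1, h2]; exact hadj
    have := hj (a.toMarked.emark x x' hadj)
    show dist _ (ξ (dite _ _ _)) < _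
    rw [dif_pos h3]
    convert this using 4
    exact RootedMarkedGraph.emark_congr _ (by rw [h1]) (by rw [h2]) _ _

/-- Needed for the Lévy–Prokhorov distance to metrize the weak topology. -/
instance GStar.instSeparableSpace [Nonempty Θ] [Nonempty Ξ]
    [SecondCountableTopology Θ] [SecondCountableTopology Ξ] :
    TopologicalSpace.SeparableSpace (GStar Θ Ξ) := by
  have : Countable (Σ n : ℕ, SimpleGraph (Fin n) × Fin n × (Fin n → ℕ) ×
      (Fin n → Fin n → ℕ)) := inferInstance
  exact ⟨⟨_, countable_range _, denseRange_finiteModel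
    (TopologicalSpace.denseRange_denseSeq Θ) (TopologicalSpace.denseRange_denseSeq Ξ)⟩⟩

end Separable

/-! ### Labelled marked graphs -/

/-- Finite sets of labels carry the discrete topology. -/
instance instTopologicalSpaceFinsetLabel : TopologicalSpace (Finset (ℕ × ℕ)) := ⊥

instance instDiscreteTopologyFinsetLabel : DiscreteTopology (Finset (ℕ × ℕ)) := ⟨rfl⟩

/-- A locally finite graph on `ℕ × ℕ`, given by finite sets of potential neighbors, with
marks. -/
def Config (Θ : Type u) (Ξ : Type w) : Type (max u w) :=
  (ℕ × ℕ → Finset (ℕ × ℕ)) × (ℕ × ℕ → Θ) × (ℕ × ℕ → ℕ × ℕ → Ξ)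

namespace Config

section Basic

variable {Θ : Type u} {Ξ : Type w}

/-- The marked graph of a configuration. -/
def toMarked (c : Config Θ Ξ) : MarkedGraph (ℕ × ℕ) Θ Ξ where
  graph :=
    -- Requiring membership on both sides turns arbitrary data into a graph, so the configuration
    -- space is a full product.
    { Adj := fun l l' => l ≠ l' ∧ l ∈ c.1 l' ∧ l' ∈ c.1 l
      symm := ⟨fun _ _ h => ⟨h.1.symm, h.2.2, h.2.1⟩⟩
      loopless := ⟨fun _ h => h.1 rfl⟩ }
  vmark := c.2.1
  emark := fun l l' _ => c.2.2 l l'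

theorem locallyFinite (c : Config Θ Ξ) (l : ℕ × ℕ) : (c.toMarked.graph.neighborSet l).Finite :=
  (c.1 l).finite_toSet.subset fun _ h => h.2.2

/-- The component of the label `(0, 0)`. -/
def toRooted (c : Config Θ Ξ) : RootedMarkedGraph Θ Ξ :=
  RootedMarkedGraph.component c.toMarked c.locallyFinite (0, 0)

/-- Bounds on the sizes of the balls and on the marks. -/
def boundedSet (S : ℕ → ℕ) (K : ℕ → Set Θ) (K' : ℕ → Set Ξ) (θ : Θ) (ξ : Ξ) :
    Set (Config Θ Ξ) :=
  (univ.pi fun l => {T | T ⊆ Finset.range (l.1 + 2) ×ˢ Finset.range (S (l.1 + 1))}) ×ˢ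
    ((univ.pi fun l => insert θ (K l.1)) ×ˢ
      (univ.pi fun l => univ.pi fun _ => insert ξ (K' l.1)))

end Basic

end Config

namespace RootedMarkedGraph

variable {Θ : Type u} {Ξ : Type w}

/-- The ball of radius `h` has at most `S h` vertices, and the marks on it and on the edges
issuing from it lie in `K h` and `K' h`, respectively. -/
def IsControlled (a : RootedMarkedGraph Θ Ξ) (S : ℕ → ℕ) (K : ℕ → Set Θ) (K' : ℕ → Set Ξ) :
    Prop :=
  ∀ h, (a.ball h).ncard ≤ S h ∧ (∀ x ∈ a.ball h, a.toMarked.vmark x ∈ K h) ∧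
    ∀ x ∈ a.ball h, ∀ y (e : a.toMarked.graph.Adj x y), a.toMarked.emark x y e ∈ K' h

/-- The label of a vertex is its distance from the root together with its index in an enumeration of
the ball of that radius. -/
theorem exists_labelling (a : RootedMarkedGraph Θ Ξ) :
    ∃ ι : a.V → ℕ × ℕ, Function.Injective ι ∧ ι a.root = (0, 0) ∧
      (∀ x h, x ∈ a.ball h ↔ (ι x).1 ≤ h) ∧ ∀ x, (ι x).2 < (a.ball (ι x).1).ncard := by
  classical
  have hlab : ∀ h, ∃ e : a.V → ℕ, InjOn e (a.ball h) ∧ ∀ x ∈ a.ball h, e x < (a.ball h).ncard := by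
    intro h
    have : Finite (a.ball h) := a.finite_ball h
    refine ⟨fun x => if hx : x ∈ a.ball h then (Finite.equivFin (a.ball h) ⟨x, hx⟩ : ℕ) else 0,
      ?_, ?_⟩
    · intro x hx y hy hxy
      simp only [dif_pos hx, dif_pos hy] at hxy
      exact congrArg Subtype.val ((Finite.equivFin (a.ball h)).injective (Fin.ext hxy))
    · intro x hx
      simp only [dif_pos hx]
      exact Fin.is_lt _
  choose e hinj hlt using hlab
  have hd : ∀ x, x ∈ a.ball (Nat.find (a.exists_mem_ball x)) := fun x =>
    Nat.find_spec (a.exists_mem_ball x)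
  refine ⟨fun x => (Nat.find (a.exists_mem_ball x), e (Nat.find (a.exists_mem_ball x)) x),
    ?_, ?_, ?_, ?_⟩
  · intro x y hxy
    obtain ⟨h1, h2⟩ := Prod.mk.inj hxy
    rw [← h1] at h2
    refine hinj _ (hd x) ?_ h2
    rw [h1]
    exact hd y
  · have h0 : Nat.find (a.exists_mem_ball a.root) = 0 :=
      (Nat.find_eq_zero _).2 (self_mem_closedBall _ _ _)
    have h1 := hlt 0 a.root (self_mem_closedBall _ _ _)
    have h2 : a.ball 0 = {a.root} := Set.ext fun x => mem_closedBall_zero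
    rw [h2, Set.ncard_singleton] at h1
    simp only [h0, Prod.mk.injEq, true_and]
    omega
  · intro x h
    exact ⟨fun hx => Nat.find_min' _ hx, fun hx => closedBall_mono _ _ hx (hd x)⟩
  · exact fun x => hlt _ x (hd x)

/-- The configuration is chosen before the bounds, so a single one obeys all of them; tightness
tests it against a whole sequence of compact sets. Labels not in use are isolated and carry the
default marks. -/
theorem exists_config (a : RootedMarkedGraph Θ Ξ) (θ : Θ) (ξ : Ξ) :
    ∃ c : Config Θ Ξ, GStar.mk c.toRooted = GStar.mk a ∧
      ∀ S K K', a.IsControlled S K K' → c ∈ Config.boundedSet S K K' θ ξ := by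
  classical
  obtain ⟨ι, hι, h0, hball, hlt⟩ := a.exists_labelling
  have hN : ∀ l, {l' | ∃ x y, ι x = l ∧ ι y = l' ∧ a.toMarked.graph.Adj x y}.Finite := by
    intro l
    by_cases hl : ∃ x, ι x = l
    · obtain ⟨x, rfl⟩ := hl
      refine ((a.locallyFinite x).image ι).subset ?_
      rintro _ ⟨x', y, hx, rfl, hadj⟩
      rw [hι hx] at hadj
      exact ⟨y, hadj, rfl⟩
    · refine Set.finite_empty.subset ?_
      rintro _ ⟨x, y, hx, -⟩
      exact hl ⟨x, hx⟩
  -- The second clause records that a non-default value belongs to an edge issuing from l, which is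
  -- what control at level `l.1` covers.
  have he : ∀ l l', ∃ t : Ξ, (∀ x y (e : a.toMarked.graph.Adj x y), ι x = l → ι y = l' →
      t = a.toMarked.emark x y e) ∧
      (t = ξ ∨ ∃ x y, ∃ e : a.toMarked.graph.Adj x y, ι x = l ∧ t = a.toMarked.emark x y e) := by
    intro l l'
    by_cases h : ∃ x y, ∃ _ : a.toMarked.graph.Adj x y, ι x = l ∧ ι y = l'
    · obtain ⟨x, y, e, hx, hy⟩ := h
      refine ⟨a.toMarked.emark x y e, fun x' y' e' hx' hy' => ?_, Or.inr ⟨x, y, e, hx, rfl⟩⟩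
      exact emark_congr _ (hι (hx.trans hx'.symm)) (hι (hy.trans hy'.symm)) _ _
    · exact ⟨ξ, fun x y e hx hy => absurd ⟨x, y, e, hx, hy⟩ h, Or.inl rfl⟩
  choose t ht ht' using he
  let c : Config Θ Ξ :=
    ⟨fun l => (hN l).toFinset, Function.extend ι a.toMarked.vmark fun _ => θ, t⟩
  have hmem : ∀ l l', l' ∈ c.1 l ↔ ∃ x y, ι x = l ∧ ι y = l' ∧ a.toMarked.graph.Adj x y :=
    fun l l' => (hN l).mem_toFinset
  have hadj : ∀ x y, c.toMarked.graph.Adj (ι x) (ι y) ↔ a.toMarked.graph.Adj x y := by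
    intro x y
    constructor
    · rintro ⟨-, -, h⟩
      obtain ⟨x', y', hx, hy, h⟩ := (hmem _ _).1 h
      rwa [hι hx, hι hy] at h
    · intro h
      exact ⟨hι.ne h.ne, (hmem _ _).2 ⟨y, x, rfl, rfl, h.symm⟩, (hmem _ _).2 ⟨x, y, rfl, rfl, h⟩⟩
  have hsupp : ∀ x, ι x ∈ (c.toMarked.graph.connectedComponentMk (0, 0)).supp := by
    intro x
    rw [SimpleGraph.ConnectedComponent.mem_supp_iff, ← h0]
    let f : a.toMarked.graph →g c.toMarked.graph := ⟨ι, fun {x y} h => (hadj x y).2 h⟩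
    exact SimpleGraph.ConnectedComponent.sound ((a.connected.preconnected x a.root).map f)
  have hsurj : ∀ y : c.toRooted.V, ∃ x, ι x = y.1 := by
    intro y
    obtain ⟨s, hs⟩ := c.toRooted.exists_mem_ball y
    rcases mem_closedBall_succ.1 (closedBall_mono _ _ (Nat.le_succ s) hs) with h | ⟨z, -, h⟩
    · exact ⟨a.root, by rw [h0, h]; rfl⟩
    · have h' : y.1 ∈ c.1 z.1 := h.2.2
      obtain ⟨x', y', hx, hy, h⟩ := (hmem _ _).1 h'
      exact ⟨y', hy⟩
  refine ⟨c, Eq.symm (Quotient.sound ?_), ?_⟩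
  · let φ : a.toMarked.graph ≃g c.toRooted.toMarked.graph :=
      { Equiv.ofBijective (fun x => (⟨ι x, hsupp x⟩ : c.toRooted.V))
          ⟨fun x y h => hι (congrArg Subtype.val h), fun y => by
            obtain ⟨x, hx⟩ := hsurj y
            exact ⟨x, Subtype.ext hx⟩⟩ with
        map_rel_iff' := fun {x y} => hadj x y }
    refine ⟨φ, Subtype.ext h0, fun v => ?_, fun x y h => ?_⟩
    · exact hι.extend_apply a.toMarked.vmark (fun _ => θ) v
    · exact ht _ _ x y h rfl rfl
  · intro S K K' hc
    refine ⟨fun l _ l' hl' => ?_, fun l _ => ?_, fun l _ l' _ => ?_⟩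
    · obtain ⟨x, y, rfl, rfl, h⟩ := (hmem _ _).1 hl'
      -- A neighbor lies at most one level further out, hence the ranges `l.1 + 2` and `S (l.1 + 1)`
      -- in `Config.boundedSet`.
      have hy : y ∈ a.ball ((ι x).1 + 1) :=
        mem_closedBall_succ_of_adj ((hball x _).2 le_rfl) h
      have h1 := (hball y _).1 hy
      have h2 : (a.ball (ι y).1).ncard ≤ (a.ball ((ι x).1 + 1)).ncard :=
        Set.ncard_le_ncard (closedBall_mono _ _ h1) (a.finite_ball _)
      have h3 := hlt y
      have h4 := (hc ((ι x).1 + 1)).1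
      simp only [Finset.mem_product, Finset.mem_range]
      omega
    · by_cases hl : ∃ x, ι x = l
      · obtain ⟨x, rfl⟩ := hl
        have : c.2.1 (ι x) = a.toMarked.vmark x := hι.extend_apply a.toMarked.vmark (fun _ => θ) x
        rw [this]
        exact Or.inr ((hc _).2.1 x ((hball x _).2 le_rfl))
      · exact Or.inl (Function.extend_apply' a.toMarked.vmark (fun _ => θ) _ hl)
    · rcases ht' l l' with h | ⟨x, y, e, rfl, h⟩
      · exact Or.inl h
      · right
        change t _ _ ∈ _
        rw [h]
        exact (hc _).2.2 x ((hball x _).2 le_rfl) y e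

end RootedMarkedGraph

namespace Config

section Topology

variable {Θ : Type u} {Ξ : Type w} [MetricSpace Θ] [MetricSpace Ξ]

instance : TopologicalSpace (Config Θ Ξ) :=
  inferInstanceAs (TopologicalSpace
    ((ℕ × ℕ → Finset (ℕ × ℕ)) × (ℕ × ℕ → Θ) × (ℕ × ℕ → ℕ × ℕ → Ξ)))

instance : T2Space (Config Θ Ξ) :=
  inferInstanceAs (T2Space
    ((ℕ × ℕ → Finset (ℕ × ℕ)) × (ℕ × ℕ → Θ) × (ℕ × ℕ → ℕ × ℕ → Ξ)))

instance : MeasurableSpace (Config Θ Ξ) := borel _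

instance : BorelSpace (Config Θ Ξ) := ⟨rfl⟩

/-- Tychonoff: every coordinate ranges over a finite or compact set. -/
theorem isCompact_boundedSet {S : ℕ → ℕ} {K : ℕ → Set Θ} {K' : ℕ → Set Ξ}
    (hK : ∀ h, IsCompact (K h)) (hK' : ∀ h, IsCompact (K' h)) (θ : Θ) (ξ : Ξ) :
    IsCompact (boundedSet S K K' θ ξ) := by
  refine IsCompact.prod (isCompact_univ_pi fun l => ?_) (IsCompact.prod
    (isCompact_univ_pi fun l => (hK _).insert θ)
    (isCompact_univ_pi fun l => isCompact_univ_pi fun _ => (hK' _).insert ξ))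
  refine Set.Finite.isCompact ((Finset.powerset (Finset.range (l.1 + 2) ×ˢ
    Finset.range (S (l.1 + 1)))).finite_toSet.subset fun T hT => ?_)
  exact Finset.mem_coe.2 (Finset.mem_powerset.2 hT)

/-- The r-ball depends on finitely many coordinates. Nearby configurations have exactly the same
neighbor sets there, by discreteness, and nearly the same marks. -/
theorem continuous_toGStar : Continuous fun c : Config Θ Ξ => GStar.mk c.toRooted := by
  refine continuous_iff_continuousAt.2 fun c => Metric.tendsto_nhds.2 fun ε hε => ?_
  obtain ⟨r, hr⟩ := exists_nat_one_div_lt (half_pos hε)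
  rw [add_comm] at hr
  have hW := finite_closedBall c.locallyFinite (0, 0) r
  set W := closedBall c.toMarked.graph (0, 0) r
  -- Adjacency is tested at both ends, so potential neighbors of the ball must be frozen too.
  set W' : Set (ℕ × ℕ) := W ∪ ⋃ l ∈ W, (c.1 l : Set (ℕ × ℕ))
  have hW' : W'.Finite := hW.union (hW.biUnion fun l _ => (c.1 l).finite_toSet)
  have hN : ∀ᶠ c' : Config Θ Ξ in 𝓝 c, ∀ l ∈ W', c'.1 l = c.1 l := by
    refine (eventually_all_finite hW').2 fun l _ => ?_
    have hc : Continuous fun c : Config Θ Ξ => c.1 l :=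
      (continuous_apply l).comp continuous_fst
    exact hc.continuousAt.eventually (p := fun T => T = c.1 l) (by simp [nhds_discrete])
  have hv : ∀ᶠ c' : Config Θ Ξ in 𝓝 c, ∀ l ∈ W', dist (c'.2.1 l) (c.2.1 l) < ε / 2 := by
    refine (eventually_all_finite hW').2 fun l _ => ?_
    have hc : Continuous fun c : Config Θ Ξ => c.2.1 l :=
      (continuous_apply l).comp (continuous_fst.comp continuous_snd)
    exact Metric.tendsto_nhds.1 hc.continuousAt _ (half_pos hε)
  have he : ∀ᶠ c' : Config Θ Ξ in 𝓝 c, ∀ l ∈ W', ∀ l' ∈ W',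
      dist (c'.2.2 l l') (c.2.2 l l') < ε / 2 := by
    refine (eventually_all_finite hW').2 fun l _ => (eventually_all_finite hW').2 fun l' _ => ?_
    have hc : Continuous fun c : Config Θ Ξ => c.2.2 l l' :=
      (continuous_apply l').comp
        ((continuous_apply l).comp (continuous_snd.comp continuous_snd))
    exact Metric.tendsto_nhds.1 hc.continuousAt _ (half_pos hε)
  filter_upwards [hN, hv, he] with c' hN hv he
  rw [dist_comm]
  refine (RootedMarkedGraph.repDist_le_of_isGood (half_pos hε) ?_).trans_lt
    (b := 1 / (1 + (r : ℝ)) + ε / 2) (by linarith)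
  have hWW : ∀ {l l'}, l ∈ W → l' ∈ c.1 l → l' ∈ W' := fun hl hl' =>
    Or.inr (mem_biUnion hl hl')
  have hball : ∀ {x : c.toRooted.V} {s : ℕ}, s ≤ r → x ∈ c.toRooted.ball s → x.1 ∈ W :=
    fun hs hx => closedBall_mono _ _ hs (RootedMarkedGraph.mem_ball_component _ |>.1 hx)
  have hadj : ∀ {l l'}, l ∈ W' → l' ∈ W' →
      (c.toMarked.graph.Adj l l' ↔ c'.toMarked.graph.Adj l l') := by
    intro l l' hl hl'
    show (l ≠ l' ∧ l ∈ c.1 l' ∧ l' ∈ c.1 l) ↔ (l ≠ l' ∧ l ∈ c'.1 l' ∧ l' ∈ c'.1 l)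
    rw [hN l hl, hN l' hl']
  refine RootedMarkedGraph.isGood_of_rel (fun x y => x.1 = y.1 ∧ x.1 ∈ W')
    ⟨rfl, Or.inl (self_mem_closedBall _ _ _)⟩ ?_ ?_ ?_ ?_ ?_ ?_ ?_
  · rintro x y y' ⟨h, -⟩ ⟨h', -⟩
    exact Subtype.ext (h.symm.trans h')
  · rintro x x' y ⟨h, -⟩ ⟨h', -⟩
    exact Subtype.ext (h.trans h'.symm)
  · rintro s hs x hx y hy ⟨h, hxW⟩ x' hxx
    have hx'W : x'.1 ∈ W' := hWW (hball hs.le hx) hxx.2.2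
    have h1 : c'.toMarked.graph.Adj y.1 x'.1 := by
      rw [← h]
      exact (hadj hxW hx'W).1 hxx
    exact ⟨⟨x'.1, RootedMarkedGraph.mem_supp_of_adj y.2 h1⟩, ⟨rfl, hx'W⟩, h1⟩
  · rintro s hs y hy x hx ⟨h, hxW⟩ y' hyy
    have h2 : y'.1 ∈ c'.1 y.1 := hyy.2.2
    rw [← h, hN _ hxW] at h2
    have hy'W : y'.1 ∈ W' := hWW (hball hs.le hx) h2
    have h1 : c.toMarked.graph.Adj x.1 y'.1 := by
      refine (hadj hxW hy'W).2 ?_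
      rw [h]
      exact hyy
    exact ⟨⟨y'.1, RootedMarkedGraph.mem_supp_of_adj x.2 h1⟩, ⟨rfl, hy'W⟩, h1⟩
  · rintro x - x' - y - y' - ⟨h, hxW⟩ ⟨h', hxW'⟩
    have : c.toMarked.graph.Adj x.1 x'.1 ↔ c'.toMarked.graph.Adj y.1 y'.1 := by
      rw [← h, ← h']
      exact hadj hxW hxW'
    exact this
  · rintro x - y - ⟨h, hxW⟩
    show dist (c.2.1 x.1) (c'.2.1 y.1) < _
    rw [← h, dist_comm]
    exact hv _ hxW
  · rintro x - x' - y - y' - ⟨h, hxW⟩ ⟨h', hxW'⟩ - -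
    show dist (c.2.2 x.1 x'.1) (c'.2.2 y.1 y'.1) < _
    rw [← h, ← h', dist_comm]
    exact he _ hxW _ hxW'

end Topology

end Config

/-! ### Uniform distributions on finite families -/

section UniformLaw

variable {V : Type} [Fintype V] [Nonempty V]

/-- The law of `f v` for a uniformly distributed `v`. -/
def uniformLaw {E : Type*} [MeasurableSpace E] (f : V → E) : ProbabilityMeasure E :=
  ⟨(Fintype.card V : ℝ≥0∞)⁻¹ • ∑ v : V, Measure.dirac (f v),
    ⟨by
      simp only [Measure.smul_apply, Measure.coe_finsetSum, Finset.sum_apply, measure_univ,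
        Finset.sum_const, Finset.card_univ, nsmul_eq_mul, mul_one, smul_eq_mul]
      exact ENNReal.inv_mul_cancel (by simp) (by simp)⟩⟩

theorem empirical_eq_uniformLaw {Θ : Type u} {Ξ : Type w} [MetricSpace Θ] [MetricSpace Ξ]
    (G : MarkedGraph V Θ Ξ) :
    empirical G = uniformLaw fun v => GStar.mk (G.rootedComponent v) := rfl

theorem uniformLaw_apply {E : Type*} [MeasurableSpace E] (f : V → E) {B : Set E}
    (hB : MeasurableSet B) :
    (uniformLaw f : Measure E) B =
      (Fintype.card V : ℝ≥0∞)⁻¹ * (({v | f v ∈ B}.ncard : ℕ) : ℝ≥0∞) := by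
  classical
  show ((Fintype.card V : ℝ≥0∞)⁻¹ • ∑ v : V, Measure.dirac (f v)) B = _
  simp only [Measure.smul_apply, Measure.coe_finsetSum, Finset.sum_apply, smul_eq_mul,
    Measure.dirac_apply' _ hB]
  congr 1
  rw [Set.ncard_eq_toFinset_card', Set.toFinset_ofPred, Finset.card_filter]
  push_cast
  refine Finset.sum_congr rfl fun v _ => ?_
  by_cases h : f v ∈ B <;> simp [h]

theorem map_uniformLaw {E F : Type*} [MeasurableSpace E] [MeasurableSpace F] (f : V → E)
    {g : E → F} (hg : Measurable g) :
    (uniformLaw f).map hg.aemeasurable = uniformLaw (g ∘ f) := by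
  refine Subtype.ext (Measure.ext fun B hB => ?_)
  show ((uniformLaw f : Measure E).map g) B = (uniformLaw (g ∘ f) : Measure F) B
  rw [Measure.map_apply hg hB, uniformLaw_apply f (hg hB), uniformLaw_apply _ hB]
  rfl

theorem inv_card_mul_ncard_le {s : Set V} {δ : ℝ}
    (h : (s.ncard : ℝ) ≤ δ * Fintype.card V) :
    (Fintype.card V : ℝ≥0∞)⁻¹ * ((s.ncard : ℕ) : ℝ≥0∞) ≤ ENNReal.ofReal δ := by
  have hc : (0 : ℝ) < Fintype.card V := by exact_mod_cast Fintype.card_pos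
  rw [mul_comm, ← div_eq_mul_inv]
  refine ENNReal.div_le_of_le_mul ?_
  rw [← ENNReal.ofReal_natCast, ← ENNReal.ofReal_natCast, ← ENNReal.ofReal_mul' hc.le]
  exact ENNReal.ofReal_le_ofReal h

/-- The same uniform vertex couples both laws, and the coupled points are δ-close outside a fraction
δ of the vertices. -/
theorem levyProkhorovDist_uniformLaw_le {E : Type*} [PseudoMetricSpace E] [MeasurableSpace E]
    [BorelSpace E] (f g : V → E) {δ : ℝ} (hδ : 0 ≤ δ)
    (h : ({v | ¬ dist (f v) (g v) < δ}.ncard : ℝ) ≤ δ * Fintype.card V) :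
    levyProkhorovDist (uniformLaw f : Measure E) (uniformLaw g : Measure E) ≤ δ := by
  refine levyProkhorovDist_le_of_forall_le _ _ hδ fun ε B hε hB => ?_
  rw [uniformLaw_apply f hB, uniformLaw_apply g Metric.isOpen_thickening.measurableSet]
  have hsub : {v | f v ∈ B} ⊆ {v | g v ∈ Metric.thickening ε B} ∪
      {v | ¬ dist (f v) (g v) < δ} := by
    intro v hv
    by_cases hd : dist (f v) (g v) < δ
    · left
      refine Metric.mem_thickening_iff.2 ⟨f v, hv, ?_⟩
      rw [dist_comm]
      exact hd.trans hε
    · exact Or.inr hd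
  have hcard : (({v | f v ∈ B}.ncard : ℕ) : ℝ≥0∞) ≤
      (({v | g v ∈ Metric.thickening ε B}.ncard : ℕ) : ℝ≥0∞) +
        (({v | ¬ dist (f v) (g v) < δ}.ncard : ℕ) : ℝ≥0∞) := by
    exact_mod_cast (Set.ncard_le_ncard hsub (Set.toFinite _)).trans (Set.ncard_union_le _ _)
  calc _ ≤ (Fintype.card V : ℝ≥0∞)⁻¹ * ((({v | g v ∈ Metric.thickening ε B}.ncard : ℕ) : ℝ≥0∞) +
        (({v | ¬ dist (f v) (g v) < δ}.ncard : ℕ) : ℝ≥0∞)) := by gcongr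
    _ ≤ _ := by
      rw [mul_add]
      gcongr
      exact (inv_card_mul_ncard_le h).trans (ENNReal.ofReal_le_ofReal hε.le)

theorem ncard_iUnion_le_tsum {V : Type} [Finite V] (s : ℕ → Set V) :
    (((⋃ j, s j).ncard : ℕ) : ℝ≥0∞) ≤ ∑' j, (((s j).ncard : ℕ) : ℝ≥0∞) := by
  let _ : MeasurableSpace V := ⊤
  have h : ∀ t : Set V, Measure.count t = ((t.ncard : ℕ) : ℝ≥0∞) := fun t => by
    rw [Measure.count_apply_finite t t.toFinite, Set.ncard_eq_toFinset_card t t.toFinite]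
  simp only [← h]
  exact measure_iUnion_le s

end UniformLaw

/-! ### Discretization of the marks -/

section Discretization

variable {Θ : Type u} {Ξ : Type w} [MetricSpace Θ] [MetricSpace Ξ]

theorem TaggedPartition.edist_proj_le {α : Type*} [MeasurableSpace α] [PseudoEMetricSpace α]
    (A : TaggedPartition α) (x : α) : edist x (A.proj x) ≤ Metric.ediam (A.cell (A.index x)) :=
  Metric.edist_le_ediam_of_mem rfl (A.tag_mem x)

theorem dist_lt_of_edist_le {α : Type*} [PseudoMetricSpace α] {x y : α} {k : ℕ+}
    (h : edist x y ≤ ENNReal.ofReal (1 / (2 * ((k : ℕ) : ℝ)))) :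
    dist x y < 1 / ((k : ℕ) : ℝ) := by
  have hk : (0 : ℝ) < ((k : ℕ) : ℝ) := by exact_mod_cast k.pos
  rw [edist_dist, ENNReal.ofReal_le_ofReal_iff (by positivity)] at h
  refine h.trans_lt (one_div_lt_one_div_of_lt hk (by linarith))

/-- Discretization leaves the graph unchanged, so the identity serves as isomorphism. A bad edge in
the ball would make its endpoints exceptional, and the bound on both entries covers either
orientation. -/
theorem isGood_mapMarks {n : ℕ} {H : SimpleGraph (Fin n)} {o : Fin n → Θ}
    {x : Sym2 (Fin n) → Ξ × Ξ} {c : Sym2 (Fin n) → Bool} {f : Θ → Θ} {g : Ξ → Ξ}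
    {N : Set Θ} {N' : Set (Ξ × Ξ)} {δ : ℝ}
    (hf : ∀ t ∉ N, dist t (f t) < δ)
    (hg : ∀ t ∉ N', dist t.1 (g t.1) < δ ∧ dist t.2 (g t.2) < δ)
    {h S : ℕ} {v : Fin n} (hv : v ∉ exceptionalCenters H (exceptionalVertices N N' H o x) h S) :
    RootedMarkedGraph.IsGood ((assemble H o x c).rootedComponent v)
      (((assemble H o x c).mapMarks f g).rootedComponent v) h δ := by
  have hD : ∀ u ∈ closedBall H v h, u ∉ exceptionalVertices N N' H o x := fun u hu huD =>
    hv (Or.inr ⟨u, hu, huD⟩)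
  have hball : ∀ u : ((assemble H o x c).rootedComponent v).ball h,
      u.1.1 ∈ closedBall H v h := fun u =>
    (RootedMarkedGraph.mem_ball_component (G := assemble H o x c)
      (hG := fun _ => Set.toFinite _) u.1).1 u.2
  refine ⟨SimpleGraph.Iso.refl, rfl, fun u => ?_, fun u u' e => ?_⟩
  · exact hf _ fun hN => hD _ (hball u) (Or.inl hN)
  · have h1 := hg (x s(u.1.1, u'.1.1)) fun hN =>
      hD _ (hball u) (Or.inr ⟨s(u.1.1, u'.1.1), ⟨e, hN⟩, Sym2.mem_mk_left _ _⟩)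
    have h2 : ∀ (q : Prop) [Decidable q],
        dist (if q then (x s(u.1.1, u'.1.1)).1 else (x s(u.1.1, u'.1.1)).2)
          (g (if q then (x s(u.1.1, u'.1.1)).1 else (x s(u.1.1, u'.1.1)).2)) < δ := by
      intro q _
      split_ifs
      · exact h1.1
      · exact h1.2
    exact h2 _

theorem expApprox_discretization [MeasurableSpace Θ] [MeasurableSpace Ξ]
    {ν : Measure Θ} [IsProbabilityMeasure ν] {χ : Measure (Ξ × Ξ)} [IsProbabilityMeasure χ]
    {Ω : ℕ+ → Type*} [∀ n, MeasurableSpace (Ω n)]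
    {P : ∀ n, Measure (Ω n)} [∀ n, IsProbabilityMeasure (P n)]
    {G : ∀ n : ℕ+, Ω n → SimpleGraph (Fin n)} {O : ∀ n : ℕ+, Ω n → Fin n → Θ}
    {X : ∀ n : ℕ+, Ω n → Sym2 (Fin n) → Ξ × Ξ} {C : ∀ n : ℕ+, Ω n → Sym2 (Fin n) → Bool}
    (hmarks : ∀ n, IsIIDMarking ν χ (P n) (G n) (O n) (X n) (C n)) (hs : Sparse P G)
    {A : ℕ+ → TaggedPartition Θ} {B : ℕ+ → TaggedPartition Ξ}
    (hgood : ∀ k : ℕ+, IsGoodPair ν χ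
      (1 / (2 * ((k : ℕ) : ℝ))) (Real.exp (-(((k : ℕ) : ℝ) ^ 2))) (A k) (B k))
    {δ : ℝ} (hδ : 0 < δ) (c : ℝ) :
    ∃ k₀ : ℕ+, ∀ k ≥ k₀, ∀ n : ℕ+,
      P n {ω | δ ≤ levyProkhorovDist
        (empirical (assemble (G n ω) (O n ω) (X n ω) (C n ω)) : Measure (GStar Θ Ξ))
        (empirical ((assemble (G n ω) (O n ω) (X n ω) (C n ω)).mapMarks (A k).proj (B k).proj) :
          Measure (GStar Θ Ξ))} ≤ ENNReal.ofReal (Real.exp (n * -c)) := by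
  -- The radius and the marks each contribute less than δ/4, so the Lévy–Prokhorov distance is at
  -- most δ/2, strictly below δ. The radius is fixed first, since S and p depend on it; of e^{-k²}
  -- only the convergence to 0 matters.
  obtain ⟨h, hh⟩ := exists_nat_one_div_lt (show 0 < δ / 2 / 2 by positivity)
  rw [add_comm] at hh
  obtain ⟨S, p, hp, hSp⟩ := hs.exists_exceptional_bound hmarks h (half_pos hδ) c
  have hk1 : ∀ᶠ k : ℕ in atTop, ENNReal.ofReal (Real.exp (-((k : ℝ) ^ 2))) < p := by
    have h1 : Tendsto (fun k : ℕ => ENNReal.ofReal (Real.exp (-((k : ℝ) ^ 2)))) atTop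
        (𝓝 (ENNReal.ofReal 0)) := by
      refine ENNReal.tendsto_ofReal (Real.tendsto_exp_atBot.comp ?_)
      exact tendsto_neg_atTop_atBot.comp
        ((tendsto_pow_atTop two_ne_zero).comp tendsto_natCast_atTop_atTop)
    rw [ENNReal.ofReal_zero] at h1
    exact h1.eventually (eventually_lt_nhds hp)
  have hk2 : ∀ᶠ k : ℕ in atTop, 1 / (k : ℝ) < δ / 2 / 2 :=
    (tendsto_one_div_atTop_nhds_zero_nat (𝕜 := ℝ)).eventually
      (eventually_lt_nhds (by positivity))
  obtain ⟨k₀, hk₀⟩ := eventually_atTop.1 (hk1.and hk2)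
  refine ⟨⟨k₀ + 1, Nat.succ_pos _⟩, fun k hk n => ?_⟩
  have hkk : k₀ ≤ (k : ℕ) := (Nat.le_succ k₀).trans hk
  obtain ⟨hkp, hkδ⟩ := hk₀ k hkk
  have hk0 : (0 : ℝ) < ((k : ℕ) : ℝ) := by exact_mod_cast k.pos
  set N : Set Θ := (A k).lastCell
  set N' : Set (Ξ × Ξ) :=
    ⋃ i, ((B k).lastCell ×ˢ (B k).cell i) ∪ ((B k).cell i ×ˢ (B k).lastCell)
  have hN : MeasurableSet N := (A k).measurable_index (measurableSet_singleton _)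
  have hcell : ∀ i, MeasurableSet ((B k).cell i) := fun i =>
    (B k).measurable_index (measurableSet_singleton i)
  have hN' : MeasurableSet N' := MeasurableSet.iUnion fun i =>
    ((hcell _).prod (hcell i)).union ((hcell i).prod (hcell _))
  have hf : ∀ t ∉ N, dist t ((A k).proj t) < 1 / ((k : ℕ) : ℝ) := fun t ht =>
    dist_lt_of_edist_le (((A k).edist_proj_le t).trans ((hgood k).diam_left _ ht))
  have hg1 : ∀ t, (B k).index t ≠ Fin.last _ → dist t ((B k).proj t) < 1 / ((k : ℕ) : ℝ) := by
    intro t ht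
    refine dist_lt_of_edist_le (le_trans ?_ ((hgood k).diam_right _ _ ht ht))
    -- The hypothesis bounds products of cells; a single cell is reached through the diagonal.
    have h1 : edist (t, t) ((B k).proj t, (B k).proj t) ≤
        Metric.ediam ((B k).cell ((B k).index t) ×ˢ (B k).cell ((B k).index t)) :=
      Metric.edist_le_ediam_of_mem ⟨rfl, rfl⟩ ⟨(B k).tag_mem t, (B k).tag_mem t⟩
    rwa [Prod.edist_eq, max_self] at h1
  have hg : ∀ t ∉ N', dist t.1 ((B k).proj t.1) < 1 / ((k : ℕ) : ℝ) ∧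
      dist t.2 ((B k).proj t.2) < 1 / ((k : ℕ) : ℝ) := by
    intro t ht
    refine ⟨hg1 _ fun h1 => ht ?_, hg1 _ fun h1 => ht ?_⟩
    · exact mem_iUnion.2 ⟨(B k).index t.2, Or.inl ⟨h1, rfl⟩⟩
    · exact mem_iUnion.2 ⟨(B k).index t.1, Or.inr ⟨rfl, h1⟩⟩
  refine (measure_mono fun ω hω => ?_).trans (hSp N N' hN hN'
    (((hgood k).measure_left).trans hkp).le (((hgood k).measure_right).trans hkp).le n)
  have hω' : δ ≤ levyProkhorovDist _ _ := hω
  by_contra hcon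
  have hcon' : ((exceptionalCenters (G n ω) (exceptionalVertices N N' (G n ω) (O n ω) (X n ω))
      h S).ncard : ℝ) ≤ δ / 2 * ((n : ℕ) : ℝ) := not_lt.1 hcon
  rw [empirical_eq_uniformLaw, empirical_eq_uniformLaw] at hω'
  refine absurd (hω'.trans (levyProkhorovDist_uniformLaw_le _ _ (half_pos hδ).le ?_))
    (not_le.2 (half_lt_self hδ))
  rw [Fintype.card_fin]
  refine le_trans ?_ hcon'
  refine Nat.cast_le.2 (Set.ncard_le_ncard (fun v hv => ?_) (Set.toFinite _))
  by_contra hvc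
  refine hv ?_
  rw [GStar.dist_mk]
  refine (RootedMarkedGraph.repDist_le_of_isGood (by positivity)
    (isGood_mapMarks hf hg hvc)).trans_lt ?_
  linarith

end Discretization

/-! ### Exponential tightness -/

section Tightness

/-- Radius h is controlled at scale max(h, J), because scales below J are allowed to fail. -/
theorem isControlled_rootedComponent {Θ : Type u} {Ξ : Type w} {n : ℕ} {H : SimpleGraph (Fin n)} {o : Fin n → Θ}
    {x : Sym2 (Fin n) → Ξ × Ξ} {c : Sym2 (Fin n) → Bool} {S : ℕ → ℕ} {K : ℕ → Set Θ}
    {K' : ℕ → Set Ξ} {J : ℕ} {v : Fin n}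
    (hv : ∀ j ≥ J, v ∉ exceptionalCenters H
      (exceptionalVertices (K j)ᶜ (K' j ×ˢ K' j)ᶜ H o x) j (S j)) :
    ((assemble H o x c).rootedComponent v).IsControlled (fun h => S (max h J))
      (fun h => K (max h J)) (fun h => K' (max h J)) := by
  intro h
  have hvj := hv (max h J) (le_max_right _ _)
  set j := max h J
  have hball : ∀ u ∈ ((assemble H o x c).rootedComponent v).ball h, u.1 ∈ closedBall H v h :=
    fun u hu => (RootedMarkedGraph.mem_ball_component (G := assemble H o x c)
      (hG := fun _ => Set.toFinite _) u).1 hu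
  have hD : ∀ u ∈ closedBall H v h,
      u ∉ exceptionalVertices (K j)ᶜ (K' j ×ˢ K' j)ᶜ H o x := fun u hu huD =>
    hvj (Or.inr ⟨u, closedBall_mono _ _ (le_max_left h J) hu, huD⟩)
  refine ⟨?_, fun u hu => ?_, fun u hu u' e => ?_⟩
  · refine le_trans ?_ (not_lt.1 fun h => hvj (Or.inl h))
    refine Set.ncard_le_ncard_of_injOn (fun u => u.1) (fun u hu => ?_)
      Subtype.val_injective.injOn (Set.toFinite _)
    exact closedBall_mono _ _ ((le_max_left h J).trans (Nat.le_add_right _ _)) (hball u hu)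
  · exact not_not.1 fun hN => hD _ (hball u hu) (Or.inl hN)
  · have h1 : x s(u.1, u'.1) ∈ K' j ×ˢ K' j := not_not.1 fun hN =>
      hD _ (hball u hu) (Or.inr ⟨s(u.1, u'.1), ⟨e, hN⟩, Sym2.mem_mk_left _ _⟩)
    show ite _ _ _ ∈ _
    split_ifs
    · exact h1.1
    · exact h1.2

variable {Θ : Type u} {Ξ : Type w} [MetricSpace Θ] [MetricSpace Ξ]

theorem exists_isCompact_measure_compl_le {α : Type*} [MetricSpace α] [CompleteSpace α]
    [SecondCountableTopology α] [MeasurableSpace α] [BorelSpace α] (μ : Measure α)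
    [IsFiniteMeasure μ] {p : ℝ≥0∞} (hp : 0 < p) : ∃ K, IsCompact K ∧ μ Kᶜ ≤ p := by
  obtain ⟨K, hK, h⟩ := isTightMeasureSet_iff_exists_isCompact_measure_compl_le.1
    (isTightMeasureSet_singleton (μ := μ)) p hp
  exact ⟨K, hK, h μ rfl⟩

theorem exists_isCompact_measure_prod_compl_le {α : Type*} [MetricSpace α] [CompleteSpace α]
    [SecondCountableTopology α] [MeasurableSpace α] [BorelSpace α] (μ : Measure (α × α))
    [IsFiniteMeasure μ] {p : ℝ≥0∞} (hp : 0 < p) : ∃ K, IsCompact K ∧ μ (K ×ˢ K)ᶜ ≤ p := by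
  obtain ⟨K, hK, h⟩ := exists_isCompact_measure_compl_le μ hp
  refine ⟨Prod.fst '' K ∪ Prod.snd '' K,
    (hK.image continuous_fst).union (hK.image continuous_snd), (measure_mono ?_).trans h⟩
  exact compl_subset_compl.2 fun x hx => ⟨Or.inl ⟨x, hx, rfl⟩, Or.inr ⟨x, hx, rfl⟩⟩

/-- If the laws of the labelled graphs put uniformly little mass outside of compact sets, so do
the laws of their isomorphism classes. -/
theorem isCompact_map_closure (D : ℕ → Set (Config Θ Ξ)) (hD : ∀ J, IsCompact (D J))
    {ε : ℕ → ℝ≥0∞} (hε : Tendsto ε atTop (𝓝 0)) :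
    IsCompact ((fun ρ : ProbabilityMeasure (Config Θ Ξ) =>
      ρ.map Config.continuous_toGStar.measurable.aemeasurable) ''
        closure {ρ | ∀ J, (ρ : Measure (Config Θ Ξ)) (D J)ᶜ ≤ ε J}) := by
  -- Prokhorov's theorem applies to the labelled laws; taking the closure avoids showing that the
  -- mass constraints are closed.
  refine IsCompact.image ?_ (ProbabilityMeasure.continuous_map Config.continuous_toGStar)
  refine isCompact_closure_of_isTightMeasureSet ?_
  rw [isTightMeasureSet_iff_exists_isCompact_measure_compl_le]
  intro η hη
  obtain ⟨J, hJ⟩ := (hε.eventually (eventually_lt_nhds hη)).exists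
  refine ⟨D J, hD J, ?_⟩
  rintro _ ⟨ρ, hρ, rfl⟩
  exact (hρ J).trans hJ.le

theorem tsum_exp_le (n : ℕ+) (c : ℝ) :
    ∑' j : ℕ, ENNReal.ofReal (Real.exp (n * -(c + (j + 1)))) ≤
      ENNReal.ofReal (Real.exp (n * -c)) := by
  have hn : (1 : ℝ) ≤ ((n : ℕ) : ℝ) := by exact_mod_cast n.pos
  have h2 : Real.exp (-1) ≤ 2⁻¹ := by
    rw [Real.exp_neg]
    have := Real.add_one_le_exp (1 : ℝ)
    exact inv_anti₀ (by norm_num) (by linarith)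
  have hj : ∀ j : ℕ, ENNReal.ofReal (Real.exp (n * -(c + (j + 1)))) ≤
      ENNReal.ofReal (Real.exp (n * -c)) * 2⁻¹ ^ (j + 1) := by
    intro j
    have h3 : (2⁻¹ : ℝ≥0∞) = ENNReal.ofReal 2⁻¹ := by
      rw [ENNReal.ofReal_inv_of_pos (by norm_num)]; simp
    rw [h3, ← ENNReal.ofReal_pow (by norm_num), ← ENNReal.ofReal_mul (by positivity)]
    apply ENNReal.ofReal_le_ofReal
    calc Real.exp (n * -(c + (j + 1)))
        ≤ Real.exp (n * -c) * Real.exp (-1) ^ (j + 1) := by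
          rw [← Real.exp_nat_mul, ← Real.exp_add, Real.exp_le_exp]
          push_cast
          have : (0 : ℝ) ≤ (j : ℝ) + 1 := by positivity
          nlinarith
      _ ≤ _ := by gcongr
  refine (ENNReal.tsum_le_tsum hj).trans ?_
  rw [ENNReal.tsum_mul_left, ENNReal.tsum_geometric_add_one, ENNReal.one_sub_inv_two, inv_inv,
    ENNReal.inv_mul_cancel (by norm_num) (by norm_num), mul_one]

theorem inv_mul_tsum_le {V : Type} [Fintype V] [Nonempty V] (s : ℕ → Set V) (J : ℕ)
    (hs : ∀ j, ((s j).ncard : ℝ) ≤ (1 / 2) ^ (J + j) * Fintype.card V) :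
    (Fintype.card V : ℝ≥0∞)⁻¹ * (((⋃ j, s j).ncard : ℕ) : ℝ≥0∞) ≤ 2⁻¹ ^ J * 2 := by
  calc (Fintype.card V : ℝ≥0∞)⁻¹ * (((⋃ j, s j).ncard : ℕ) : ℝ≥0∞)
      ≤ ∑' j, (Fintype.card V : ℝ≥0∞)⁻¹ * (((s j).ncard : ℕ) : ℝ≥0∞) := by
        rw [ENNReal.tsum_mul_left]
        gcongr
        exact ncard_iUnion_le_tsum s
    _ ≤ ∑' j, 2⁻¹ ^ J * 2⁻¹ ^ j := by
        refine ENNReal.tsum_le_tsum fun j => (inv_card_mul_ncard_le (hs j)).trans ?_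
        rw [ENNReal.ofReal_pow (by norm_num), one_div, ENNReal.ofReal_inv_of_pos (by norm_num),
          pow_add]
        simp
    _ = 2⁻¹ ^ J * 2 := by
        rw [ENNReal.tsum_mul_left, ENNReal.tsum_geometric, ENNReal.one_sub_inv_two, inv_inv]

/-- Outside a union over scales of rare events, at most a fraction 2^{-j} of the vertices is spoiled
at each scale j. The vertices spoiled at some scale j ≥ J form a fraction of at most 2·2^{-J}, and
all others have configurations in the compact set `D J`. -/
theorem expTight_empirical [CompleteSpace Θ] [SecondCountableTopology Θ]
    [MeasurableSpace Θ] [BorelSpace Θ] [CompleteSpace Ξ] [SecondCountableTopology Ξ]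
    [MeasurableSpace Ξ] [BorelSpace Ξ]
    {ν : Measure Θ} [IsProbabilityMeasure ν] {χ : Measure (Ξ × Ξ)} [IsProbabilityMeasure χ]
    {Ω : ℕ+ → Type*} [∀ n, MeasurableSpace (Ω n)]
    {P : ∀ n, Measure (Ω n)} [∀ n, IsProbabilityMeasure (P n)]
    {G : ∀ n : ℕ+, Ω n → SimpleGraph (Fin n)} {O : ∀ n : ℕ+, Ω n → Fin n → Θ}
    {X : ∀ n : ℕ+, Ω n → Sym2 (Fin n) → Ξ × Ξ} {C : ∀ n : ℕ+, Ω n → Sym2 (Fin n) → Bool}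
    (hmarks : ∀ n, IsIIDMarking ν χ (P n) (G n) (O n) (X n) (C n)) (hs : Sparse P G) :
    ExpTight P fun n ω => empirical (assemble (G n ω) (O n ω) (X n ω) (C n ω)) := by
  intro c
  obtain ⟨θ⟩ := nonempty_of_isProbabilityMeasure ν
  obtain ⟨ξ, -⟩ := nonempty_of_isProbabilityMeasure χ
  -- The fractions 2^{-j} and the probabilities e^{-n(c+j+1)} are both summable in j. Summing at
  -- each fixed n is where uniformity in n is used.
  have hbound := fun j : ℕ => hs.exists_exceptional_bound hmarks j
    (show (0 : ℝ) < (1 / 2) ^ j by positivity) (c + (j + 1))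
  choose S p hp hSp using hbound
  choose K hK hKν using fun j => exists_isCompact_measure_compl_le ν (hp j)
  choose K' hK' hKχ using fun j => exists_isCompact_measure_prod_compl_le χ (hp j)
  choose conf hconf hconf' using fun a : RootedMarkedGraph Θ Ξ => a.exists_config θ ξ
  let D : ℕ → Set (Config Θ Ξ) := fun J => Config.boundedSet (fun h => S (max h J))
    (fun h => K (max h J)) (fun h => K' (max h J)) θ ξ
  have hD : ∀ J, IsCompact (D J) := fun J =>
    Config.isCompact_boundedSet (fun h => hK _) (fun h => hK' _) θ ξ
  have hε : Tendsto (fun J : ℕ => (2⁻¹ : ℝ≥0∞) ^ J * 2) atTop (𝓝 0) := by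
    have h1 := ENNReal.Tendsto.mul_const (b := 2)
      (ENNReal.tendsto_pow_atTop_nhds_zero_of_lt_one (r := 2⁻¹) (by simp))
      (Or.inr (by norm_num))
    rwa [zero_mul] at h1
  refine ⟨_, isCompact_map_closure D hD hε, fun n => ?_⟩
  let E : ℕ → Ω n → Set (Fin n) := fun j ω => exceptionalCenters (G n ω)
    (exceptionalVertices (K j)ᶜ (K' j ×ˢ K' j)ᶜ (G n ω) (O n ω) (X n ω)) j (S j)
  have hP : ∀ j, P n {ω | (1 / 2) ^ j * ((n : ℕ) : ℝ) < ((E j ω).ncard : ℝ)} ≤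
      ENNReal.ofReal (Real.exp (n * -(c + (j + 1)))) := fun j =>
    hSp j _ _ (hK j).measurableSet.compl
      ((hK' j).measurableSet.prod (hK' j).measurableSet).compl (hKν j) (hKχ j) n
  refine le_trans (measure_mono (t := ⋃ j : ℕ, {ω | (1 / 2) ^ j * ((n : ℕ) : ℝ) <
      ((E j ω).ncard : ℝ)}) ?_)
    ((measure_iUnion_le _).trans ((ENNReal.tsum_le_tsum hP).trans (tsum_exp_le n c)))
  intro ω hω
  by_contra hcon
  have hE : ∀ j, ((E j ω).ncard : ℝ) ≤ (1 / 2) ^ j * ((n : ℕ) : ℝ) := by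
    intro j
    exact not_lt.1 fun h => hcon (mem_iUnion.2 ⟨j, h⟩)
  refine hω ?_
  let f : Fin n → Config Θ Ξ := fun v =>
    conf ((assemble (G n ω) (O n ω) (X n ω) (C n ω)).rootedComponent v)
  refine ⟨uniformLaw f, subset_closure fun J => ?_, ?_⟩
  · rw [uniformLaw_apply f (hD J).measurableSet.compl]
    refine le_trans ?_ (inv_mul_tsum_le (fun j => E (J + j) ω) J fun j => by
      rw [Fintype.card_fin]; exact hE (J + j))
    gcongr
    · exact Set.toFinite _
    intro v hv
    by_contra hvE
    refine hv (hconf' _ _ _ _ (isControlled_rootedComponent fun j hj hvj => hvE ?_))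
    exact mem_iUnion.2 ⟨j - J, by rwa [Nat.add_sub_cancel' hj]⟩
  · change (uniformLaw f).map _ = _
    rw [map_uniformLaw f Config.continuous_toGStar.measurable]
    refine Eq.trans ?_ (empirical_eq_uniformLaw _).symm
    congr 1
    funext v
    exact hconf _

end Tightness

end SparseLDP

end

/-! ### Conclusion -/

theorem mainTheorem7 {Θ : Type*} {Ξ : Type*}
    [MetricSpace Θ] [CompleteSpace Θ] [SecondCountableTopology Θ]
    [MeasurableSpace Θ] [BorelSpace Θ]
    [MetricSpace Ξ] [CompleteSpace Ξ] [SecondCountableTopology Ξ]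
    [MeasurableSpace Ξ] [BorelSpace Ξ]
    (ν : Measure Θ) [IsProbabilityMeasure ν] (χ : Measure (Ξ × Ξ)) [IsProbabilityMeasure χ]
    {Ω : ℕ+ → Type*} [∀ n, MeasurableSpace (Ω n)]
    (P : ∀ n, Measure (Ω n)) [∀ n, IsProbabilityMeasure (P n)]
    (G : ∀ n : ℕ+, Ω n → SimpleGraph (Fin n))
    (O : ∀ n : ℕ+, Ω n → Fin n → Θ)
    (X : ∀ n : ℕ+, Ω n → Sym2 (Fin n) → Ξ × Ξ)
    (C : ∀ n : ℕ+, Ω n → Sym2 (Fin n) → Bool)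
    (hmarks : ∀ n, SparseLDP.IsIIDMarking ν χ (P n) (G n) (O n) (X n) (C n))
    (hsparse : SparseLDP.Sparse P G)
    (A : ℕ+ → SparseLDP.TaggedPartition Θ) (B : ℕ+ → SparseLDP.TaggedPartition Ξ)
    (hgood : ∀ k : ℕ+, SparseLDP.IsGoodPair ν χ
      (1 / (2 * ((k : ℕ) : ℝ))) (Real.exp (-(((k : ℕ) : ℝ) ^ 2))) (A k) (B k))
    (I : ℕ+ → ProbabilityMeasure (SparseLDP.GStar Θ Ξ) → ℝ≥0∞)
    (hLDP : ∀ k : ℕ+, SparseLDP.SatisfiesLDP P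
      (fun n ω => SparseLDP.empirical
        ((SparseLDP.assemble (G n ω) (O n ω) (X n ω) (C n ω)).mapMarks (A k).proj (B k).proj))
      (I k)) :
    SparseLDP.SatisfiesLDP P
      (fun n ω => SparseLDP.empirical
        (SparseLDP.assemble (G n ω) (O n ω) (X n ω) (C n ω)))
      (fun μ => limsup (fun δ : ℝ => limsup (fun k : ℕ+ =>
        ⨅ ρ ∈ {ρ : ProbabilityMeasure (SparseLDP.GStar Θ Ξ) |
          levyProkhorovDist (μ : Measure (SparseLDP.GStar Θ Ξ)) ρ < δ}, I k ρ) atTop)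
        (𝓝[>] (0 : ℝ))) := by
  have : Nonempty Θ := nonempty_of_isProbabilityMeasure ν
  have : Nonempty Ξ := (nonempty_of_isProbabilityMeasure χ).map Prod.fst
  -- The Lévy–Prokhorov distance is pulled back while the weak topology is kept, so `limitRate`
  -- unfolds to the stated rate and open and closed sets are the weak ones.
  let _ : PseudoMetricSpace (ProbabilityMeasure (SparseLDP.GStar Θ Ξ)) :=
    (LevyProkhorov.probabilityMeasureHomeomorph
      (Ω := SparseLDP.GStar Θ Ξ)).isInducing.comapPseudoMetricSpace
  have happ : SparseLDP.ExpApprox P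
      (fun n ω => SparseLDP.empirical (SparseLDP.assemble (G n ω) (O n ω) (X n ω) (C n ω)))
      (fun k n ω => SparseLDP.empirical
        ((SparseLDP.assemble (G n ω) (O n ω) (X n ω) (C n ω)).mapMarks
          (A k).proj (B k).proj)) :=
    fun _ hδ c => SparseLDP.expApprox_discretization hmarks hsparse hgood hδ c
  exact happ.satisfiesLDP hLDP (SparseLDP.expTight_empirical hmarks hsparse)
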